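/- Let $\mathcal{L}=\{(n,m)\in\mathbb{Z}^2 : n+m \text{ even},\ n\ge 0\}$ and let $p\in[0,1]$. Consider the oriented site percolation model on $\mathcal{L}$ in which the sites are occupied independently, each with probability $p$; an occupied site $(n,m)$ has arrows to $(n+1,m+1)$, $(n+2,m)$ and $(n+1,m-1)$, and a vacant site has no arrows. (This is oriented triangular site percolation, rotated and scaled.) Write $x\to y$ if there is a finite, possibly empty, path of arrows from $x$ to $y$. Let $\mathbf{C}_o=\{y\in\mathcal{L}: o\to y\}$ be the forward cluster of the origin $o=(0,0)$, and let $$p_c=\inf\{p\in[0,1] : \mathbb{P}_p(|\mathbf{C}_o|=\infty)>0\}.$$ For $n\ge 1$ let $$\overline{u}_n=\sup\{x : \text{there is } y\le 0 \text{ with } (0,y)\to(n,x) \text{ or } (1,y)\to(n,x)\}$$ (all points are in $\mathcal{L}$, and $\sup\varnothing=-\infty$), and define the edge speed $$\alpha[p]=\inf_{n\ge 1}\mathbb{E}_p\Big[\frac{\overline{u}_n}{n}\Big]\in[-\infty,1].$$ Then $\alpha[p_c]=0$, and $\alpha$ is finite and continuous on $[p_c,1]$. -/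

import Mathlib

open MeasureTheory

noncomputable section

namespace OTSP

/-- The lattice `𝓛 = {(n, m) ∈ ℤ² : n + m even, n ≥ 0}` of the rotated model. -/
abbrev Site : Type := {z : ℤ × ℤ // Even (z.1 + z.2) ∧ 0 ≤ z.1}

/-- The origin of the lattice. -/
def origin : Site := ⟨(0, 0), by simp⟩

/-- A label in `[0, 1]` at every site. -/
abbrev Labels : Type := Site → unitInterval

/-- The law under which the labels are i.i.d. uniform on `[0, 1]`. -/
def law : Measure Labels :=
  Measure.infinitePi fun _ : Site => (volume : Measure unitInterval)

/-- At parameter `p` the site `z` is occupied if its label is less than `p`; so for `p ∈ [0, 1]`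
the sites are occupied independently, each with probability `p`. -/
def Occupied (p : ℝ) (U : Labels) (z : Site) : Prop := (U z : ℝ) < p

/-- An occupied site `(n, m)` has arrows to `(n + 1, m + 1)`, `(n + 2, m)` and `(n + 1, m - 1)`;
a vacant site has none. -/
def Arrow (p : ℝ) (U : Labels) (a b : Site) : Prop :=
  Occupied p U a ∧
    (b.1 = a.1 + (1, 1) ∨ b.1 = a.1 + (2, 0) ∨ b.1 = a.1 + (1, -1))

/-- `a → b`: there is a finite (possibly empty) path of arrows from `a` to `b`. -/
def Connected (p : ℝ) (U : Labels) (a b : Site) : Prop :=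
  Relation.ReflTransGen (Arrow p U) a b

/-- The forward cluster of the origin. -/
def cluster (p : ℝ) (U : Labels) : Set Site := {b | Connected p U origin b}

/-- The probability that the forward cluster of the origin is infinite. -/
def percolationProb (p : ℝ) : ENNReal := law {U | (cluster p U).Infinite}

/-- The critical value: the infimum of the `p ∈ [0, 1]` with positive percolation probability. -/
def criticalValue : ℝ := sInf {p : ℝ | p ∈ Set.Icc (0 : ℝ) 1 ∧ 0 < percolationProb p}

/-- The heights `x` such that `(n, x)` can be reached from a site `(0, y)` or `(1, y)`
with `y ≤ 0`. -/
def reachedFromBelow (p : ℝ) (U : Labels) (n : ℕ) : Set ℤ :=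
  {x | ∃ a b : Site, (a.1.1 = 0 ∨ a.1.1 = 1) ∧ a.1.2 ≤ 0 ∧ b.1 = ((n : ℤ), x) ∧
    Connected p U a b}

/-- The upper edge at level `n`: the supremum of `reachedFromBelow p U n` in `[-∞, ∞]`
(equal to `-∞` if that set is empty). -/
def upperEdge (p : ℝ) (U : Labels) (n : ℕ) : EReal :=
  ⨆ x ∈ reachedFromBelow p U n, ((x : ℝ) : EReal)

/-- The expectation of an extended real random variable, as the difference of the integrals of
its positive and negative parts. It is used only for variables that are bounded above, where
it takes values in `[-∞, ∞)`. -/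
def expectation (X : Labels → EReal) : EReal :=
  ((∫⁻ U, (X U).toENNReal ∂law : ENNReal) : EReal) -
    ((∫⁻ U, (-X U).toENNReal ∂law : ENNReal) : EReal)

/-- The edge speed: the infimum over `n ≥ 1` of the expectation of `upperEdge p · n / n`. -/
def edgeSpeed (p : ℝ) : EReal :=
  ⨅ (n : ℕ) (_ : 1 ≤ n), expectation fun U => upperEdge p U n / (n : EReal)

end OTSP

end

noncomputable section

namespace OTSP

open Filter Topology

/-!
The upper edge is subadditive in law, so its upper tail above the speed `α` is exponentially small,
and the first moment then controls its lower tail. Hence, if `α > 0`, a long thin tube of slope `α`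
is crossed from left to right with high probability, and by reflection so is one of slope `-α`.
Paths in the triangular lattice that exchange their order have a common site, so crossings of
tubes of slopes `a` and `-a` placed along a line of slightly smaller slope combine to a crossing of
a much longer tube. Two disjoint parallel copies of the longer tube square the probability of
failure, and the construction can be iterated over all scales with a summable loss of slope.

Consequently, for `0 < b < α[p]`, a single crossing event in a bounded region, whose probability is
continuous in the parameter, forces `α[q] ≥ b` and percolation at `q`, for all `q` near `p`. This
gives `α[p_c] ≤ 0` and lower semicontinuity where `α > 0`. Upper semicontinuity holds since `α` is
an infimum of continuous expectations. Above `p_c` the edge cannot have negative speed, by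
reflection symmetry, and `α[p_c] ≥ 0` follows by upper semicontinuity.
-/

/-! ### Generalities -/

lemma exists_pos_mgf_lt_one {Ω : Type*} [MeasurableSpace Ω] {μ : Measure Ω}
    [IsProbabilityMeasure μ] {X : Ω → ℝ}
    (hX : 0 ∈ interior (ProbabilityTheory.integrableExpSet X μ))
    (hneg : ∫ ω, X ω ∂μ < 0) : ∃ θ : ℝ, 0 < θ ∧ ProbabilityTheory.mgf X μ θ < 1 := by
  have hderiv := ProbabilityTheory.hasDerivAt_mgf hX
  simp only [zero_mul, Real.exp_zero, mul_one] at hderiv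
  obtain ⟨θ, hlt, hθ⟩ := ((((hasDerivAt_iff_tendsto_slope.1 hderiv).mono_left
    (nhdsGT_le_nhdsNE 0)).eventually_lt_const hneg).and self_mem_nhdsWithin).exists
  refine ⟨θ, hθ, ?_⟩
  rw [slope_def_field, ProbabilityTheory.mgf_zero, sub_zero, div_lt_iff₀ hθ, zero_mul,
    sub_neg] at hlt
  exact hlt

lemma exists_even_add_intCast_mem_Ioc (m : ℤ) (r : ℝ) :
    ∃ z : ℤ, Even (m + z) ∧ (z : ℝ) ∈ Set.Ioc (r - 2) r := by
  refine ⟨m + 2 * ⌊(r - m) / 2⌋, ⟨m + ⌊(r - m) / 2⌋, by ring⟩, ?_, ?_⟩ <;> push_cast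
  · linarith [Int.lt_floor_add_one ((r - m) / 2)]
  · linarith [Int.floor_le ((r - m) / 2)]

lemma measure_iInter_ne_zero_of_hasSum_lt_one {Ω : Type*} [MeasurableSpace Ω] {μ : Measure Ω}
    [IsProbabilityMeasure μ] {A : ℕ → Set Ω} {u : ℕ → ℝ} {r : ℝ} (hu : HasSum u r) (hr : r < 1)
    (hA : ∀ k, μ.real (A k)ᶜ ≤ u k) : μ (⋂ k, A k) ≠ 0 := by
  intro hzero
  have hu0 (k : ℕ) : 0 ≤ u k := measureReal_nonneg.trans (hA k)
  have hcompl : μ (⋂ k, A k)ᶜ < 1 :=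
    calc μ (⋂ k, A k)ᶜ ≤ ∑' k, μ (A k)ᶜ := by
          rw [Set.compl_iInter]
          exact measure_iUnion_le _
      _ ≤ ∑' k, ENNReal.ofReal (u k) := ENNReal.tsum_le_tsum fun k => by
          rw [← ofReal_measureReal]
          exact ENNReal.ofReal_le_ofReal (hA k)
      _ = ENNReal.ofReal r := by rw [← ENNReal.ofReal_tsum_of_nonneg hu0 hu.summable, hu.tsum_eq]
      _ < 1 := by rwa [ENNReal.ofReal_lt_one]
  have huniv := measure_union_le (μ := μ) (⋂ k, A k) (⋂ k, A k)ᶜ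
  rw [Set.union_compl_self, measure_univ, hzero, zero_add] at huniv
  exact huniv.not_gt hcompl

variable {p p' : ℝ} {U : Labels} {f g h : ℕ → ℤ} {s t e : ℕ}

/-! ### Paths as height functions -/

/-- The site at column `n` and height `m`. -/
def siteAt (n : ℕ) (m : ℤ) (h : Even ((n : ℤ) + m)) : Site :=
  ⟨((n : ℤ), m), h, Int.natCast_nonneg n⟩

/-- The point `(n, m)` is an occupied site of the lattice. -/
def OccupiedAt (p : ℝ) (U : Labels) (n : ℕ) (m : ℤ) : Prop :=
  ∃ h : Even ((n : ℤ) + m), Occupied p U (siteAt n m h)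

/-- `h` is the height function of an open path over the columns `s, …, e`. A column `n` with
`n + h n` odd is passed in the middle of an arrow of length two. -/
def IsPath (p : ℝ) (U : Labels) (h : ℕ → ℤ) (s e : ℕ) : Prop :=
  ∀ n, s ≤ n → n < e → (OccupiedAt p U n (h n) ∧ |h (n + 1) - h n| ≤ 1) ∨
    (¬ Even ((n : ℤ) + h n) ∧ h (n + 1) = h n)

/-- The graph of `f` over the columns `s, …, e` lies in `S`. -/
def GraphIn (f : ℕ → ℤ) (s e : ℕ) (S : Set (ℕ × ℤ)) : Prop :=
  ∀ n, s ≤ n → n ≤ e → (n, f n) ∈ S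

/-- Some path with graph in `S` leads from `(s, y)` to `(e, x)`. -/
def Reach (p : ℝ) (U : Labels) (S : Set (ℕ × ℤ)) (s : ℕ) (y : ℤ) (e : ℕ) (x : ℤ) : Prop :=
  s ≤ e ∧ ∃ h, IsPath p U h s e ∧ GraphIn h s e S ∧ h s = y ∧ h e = x

lemma OccupiedAt.mono (hpp' : p ≤ p') {n : ℕ} {m : ℤ} (hocc : OccupiedAt p U n m) :
    OccupiedAt p' U n m :=
  let ⟨heven, hlt⟩ := hocc
  ⟨heven, hlt.trans_le hpp'⟩

lemma OccupiedAt.even {n : ℕ} {m : ℤ} (hocc : OccupiedAt p U n m) : Even ((n : ℤ) + m) :=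
  hocc.1

namespace IsPath

lemma refl (s : ℕ) : IsPath p U h s s := fun _ hs he => absurd hs he.not_ge

lemma mono (hpp' : p ≤ p') (hh : IsPath p U h s e) : IsPath p' U h s e :=
  fun n hs he => (hh n hs he).imp_left fun ⟨hocc, hstep⟩ => ⟨hocc.mono hpp', hstep⟩

lemma sub {s' e' : ℕ} (hh : IsPath p U h s e) (hs : s ≤ s') (he : e' ≤ e) :
    IsPath p U h s' e' :=
  fun n hn hn' => hh n (hs.trans hn) (hn'.trans_le he)

lemma congr (hf : IsPath p U f s e) (hfg : ∀ n, s ≤ n → n ≤ e → f n = g n) :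
    IsPath p U g s e := by
  intro n hs he
  rw [← hfg n hs he.le, ← hfg (n + 1) (by omega) he]
  exact hf n hs he

lemma abs_step_le (hh : IsPath p U h s e) {n : ℕ} (hs : s ≤ n) (he : n < e) :
    |h (n + 1) - h n| ≤ 1 := by
  rcases hh n hs he with ⟨-, hstep⟩ | ⟨-, heq⟩
  · exact hstep
  · simp [heq]

lemma abs_sub_le (hh : IsPath p U h s e) {m n : ℕ} (hs : s ≤ m) (hmn : m ≤ n) (he : n ≤ e) :
    |h n - h m| ≤ (n : ℤ) - m := by
  induction n, hmn using Nat.le_induction with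
  | base => simp
  | succ n hmn ih =>
    calc |h (n + 1) - h m| ≤ |h (n + 1) - h n| + |h n - h m| := _root_.abs_sub_le _ _ _
      _ ≤ 1 + ((n : ℤ) - m) :=
        add_le_add (hh.abs_step_le (hs.trans hmn) he) (ih (by omega))
      _ = ((n + 1 : ℕ) : ℤ) - m := by push_cast; ring

lemma glue (hf : IsPath p U f s t) (hg : IsPath p U g t e) (ht : f t = g t) :
    IsPath p U (fun n => if n ≤ t then f n else g n) s e := by
  intro n hs he
  rcases lt_trichotomy n t with hlt | rfl | hgt
  · simpa [hlt.le, Nat.succ_le_of_lt hlt] using hf n hs hlt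
  · simpa [ht] using hg n le_rfl he
  · simpa [hgt.not_ge, (Nat.lt_succ_of_lt hgt).not_ge] using hg n hgt.le he

-- A diagonal arrow passes neither an arrow of length two nor, by parity, another diagonal one.
lemma le_succ_of_lt (hf : IsPath p U f s e) (hg : IsPath p U g s e) {n : ℕ} (hs : s ≤ n)
    (he : n < e) (hlt : f n < g n) : f (n + 1) ≤ g (n + 1) := by
  rcases hf n hs he with ⟨hfo, hf'⟩ | ⟨-, hf'⟩ <;> rcases hg n hs he with ⟨hgo, hg'⟩ | ⟨-, hg'⟩
  · have hfe := Int.even_iff.1 hfo.even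
    have hge := Int.even_iff.1 hgo.even
    rw [abs_le] at hf' hg'
    omega
  · rw [abs_le] at hf'; omega
  · rw [abs_le] at hg'; omega
  · omega

lemma exists_meet (hf : IsPath p U f s e) (hg : IsPath p U g s e) (hse : s ≤ e)
    (hs : f s ≤ g s) (he : g e ≤ f e) : ∃ n, s ≤ n ∧ n ≤ e ∧ f n = g n := by
  by_contra! hne
  have hlt : ∀ n, s ≤ n → n ≤ e → f n < g n := by
    intro n hn
    induction n, hn using Nat.le_induction with
    | base => exact fun _ => hs.lt_of_ne (hne s le_rfl hse)
    | succ n hn ih =>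
      intro hne'
      exact (hf.le_succ_of_lt hg hn hne' (ih (by omega))).lt_of_ne (hne _ (by omega) hne')
  exact (hlt e hse le_rfl).not_ge he

lemma reach {S : Set (ℕ × ℤ)} (hf : IsPath p U f s e) (hS : GraphIn f s e S)
    {m n : ℕ} (hm : s ≤ m) (hmn : m ≤ n) (hn : n ≤ e) : Reach p U S m (f m) n (f n) :=
  ⟨hmn, f, hf.sub hm hn, fun k hk hk' => hS k (hm.trans hk) (hk'.trans hn), rfl, rfl⟩

end IsPath

lemma Reach.trans {S : Set (ℕ × ℤ)} {x y z : ℤ} (hxy : Reach p U S s x t y)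
    (hyz : Reach p U S t y e z) : Reach p U S s x e z := by
  obtain ⟨hst, f, hf, hfS, rfl, rfl⟩ := hxy
  obtain ⟨hte, g, hg, hgS, hgt, rfl⟩ := hyz
  refine ⟨hst.trans hte, _, hf.glue hg hgt.symm, fun n hs he => ?_, by simp [hst], ?_⟩
  · dsimp only
    split_ifs with hn
    · exact hfS n hs hn
    · exact hgS n (by omega) he
  · split_ifs with he
    · rw [le_antisymm he hte, hgt]
    · rfl

lemma reach_of_connector {S : Set (ℕ × ℤ)} {f' : ℕ → ℤ} (hf : IsPath p U f s e)
    (hg : IsPath p U g s e) (hf' : IsPath p U f' s e) (hse : s ≤ e)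
    (hfS : GraphIn f s e S) (hgS : GraphIn g s e S) (hfS' : GraphIn f' s e S)
    (hs : f s ≤ g s) (he : g e ≤ f' e) (hff' : ∀ n, s ≤ n → n ≤ e → f' n ≤ f n) :
    Reach p U S s (f s) e (f' e) := by
  obtain ⟨n, hn, hn', hfg⟩ := hf.exists_meet hg hse hs (he.trans (hff' e hse le_rfl))
  obtain ⟨m, hm, hm', hgf⟩ := (hf'.sub hn le_rfl).exists_meet (hg.sub hn le_rfl) hn'
    ((hff' n hn hn').trans hfg.le) he
  have along_f := hf.reach hfS le_rfl hn hn'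
  have along_g := hg.reach hgS hn hm hm'
  have along_f' := hf'.reach hfS' (hn.trans hm) hm' le_rfl
  rw [hfg] at along_f
  rw [← hgf] at along_g
  exact (along_f.trans along_g).trans along_f'

/-! ### Paths and connections of sites -/

lemma natCast_toNat_fst (a : Site) : ((a.1.1.toNat : ℕ) : ℤ) = a.1.1 := Int.toNat_of_nonneg a.2.2

lemma OccupiedAt.of_occupied {a : Site} (ha : Occupied p U a) :
    OccupiedAt p U a.1.1.toNat a.1.2 := by
  have hcol := natCast_toNat_fst a
  have heven : Even ((a.1.1.toNat : ℤ) + a.1.2) := by rw [hcol]; exact a.2.1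
  have hsite : siteAt a.1.1.toNat a.1.2 heven = a := Subtype.ext (Prod.ext hcol rfl)
  exact ⟨heven, by rwa [hsite]⟩

lemma Arrow.reach {a b : Site} (hab : Arrow p U a b) :
    Reach p U Set.univ a.1.1.toNat a.1.2 b.1.1.toNat b.1.2 := by
  obtain ⟨hocc, harr⟩ := hab
  have hopen := OccupiedAt.of_occupied hocc
  have heven := Int.even_iff.1 a.2.1
  have hcol := natCast_toNat_fst a
  set m := a.1.1.toNat
  have hcases : b.1.1 = a.1.1 + 2 ∧ b.1.2 = a.1.2 ∨
      b.1.1 = a.1.1 + 1 ∧ |b.1.2 - a.1.2| ≤ 1 := by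
    rcases harr with h | h | h <;> simp [h]
  rcases hcases with ⟨hcol', hht⟩ | ⟨hcol', hht⟩
  · have hm : b.1.1.toNat = m + 2 := by omega
    refine ⟨by omega, fun _ => a.1.2, fun n hs he => ?_, fun _ _ _ => trivial, rfl, hht.symm⟩
    obtain rfl | rfl : n = m ∨ n = m + 1 := by omega
    · exact Or.inl ⟨hopen, by simp⟩
    · exact Or.inr ⟨by rw [Int.even_iff]; push_cast; omega, rfl⟩
  · have hm : b.1.1.toNat = m + 1 := by omega
    refine ⟨by omega, fun n => if n = m then a.1.2 else b.1.2, fun n hs he => ?_,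
      fun _ _ _ => trivial, by simp, by simp [hm]⟩
    obtain rfl : n = m := by omega
    exact Or.inl ⟨by simpa using hopen, by simpa using hht⟩

lemma Connected.reach {a b : Site} (hab : Connected p U a b) :
    Reach p U Set.univ a.1.1.toNat a.1.2 b.1.1.toNat b.1.2 := by
  induction hab with
  | refl => exact ⟨le_rfl, fun _ => a.1.2, IsPath.refl _, fun _ _ _ => trivial, rfl, rfl⟩
  | tail _ hbc ih => exact ih.trans hbc.reach

lemma IsPath.exists_arrow (hh : IsPath p U h s e) (hse : s < e) (hs : Even ((s : ℤ) + h s))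
    (he : Even ((e : ℤ) + h e)) :
    ∃ (k : ℕ) (hk : Even ((k : ℤ) + h k)), s ≤ k ∧ k < e ∧
      Arrow p U (siteAt k (h k) hk) (siteAt e (h e) he) := by
  obtain ⟨k, rfl⟩ : ∃ k, e = k + 1 := ⟨e - 1, by omega⟩
  have he' := Int.even_iff.1 he
  push_cast at he'
  rcases hh k (by omega) (by omega) with ⟨hocc, hstep⟩ | ⟨hodd, heq⟩
  · have hk := Int.even_iff.1 hocc.even
    refine ⟨k, hocc.even, by omega, by omega, hocc.2, ?_⟩
    rw [abs_le] at hstep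
    obtain hup | hdown : h (k + 1) = h k + 1 ∨ h (k + 1) = h k - 1 := by omega
    · exact Or.inl (by ext <;> simp [siteAt, hup])
    · exact Or.inr (Or.inr (by ext <;> simp [siteAt, hdown, sub_eq_add_neg]))
  · have hsk : s ≠ k := fun hsk => hodd (hsk ▸ hs)
    obtain ⟨j, rfl⟩ : ∃ j, k = j + 1 := ⟨k - 1, by omega⟩
    rw [Int.even_iff] at hodd
    push_cast at hodd
    rcases hh j (by omega) (by omega) with ⟨hocc, hstep⟩ | ⟨hodd', heq'⟩
    · have hj := Int.even_iff.1 hocc.even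
      rw [abs_le] at hstep
      have hlevel : h (j + 1 + 1) = h j := by omega
      refine ⟨j, hocc.even, by omega, by omega, hocc.2, Or.inr (Or.inl ?_)⟩
      ext
      · simp [siteAt, add_assoc]
      · simp [siteAt, hlevel]
    · rw [Int.even_iff] at hodd'
      omega

lemma IsPath.connected (hh : IsPath p U h s e) (hse : s ≤ e) (hs : Even ((s : ℤ) + h s))
    (he : Even ((e : ℤ) + h e)) : Connected p U (siteAt s (h s) hs) (siteAt e (h e) he) := by
  induction e using Nat.strong_induction_on with
  | _ e ih =>
    rcases hse.eq_or_lt with rfl | hlt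
    · exact Relation.ReflTransGen.refl
    · obtain ⟨k, hk, hsk, hke, harrow⟩ := hh.exists_arrow hlt hs he
      exact (ih k hke (hh.sub le_rfl hke.le) hsk hk).tail harrow

/-! ### Symmetries and independence -/

instance : IsProbabilityMeasure law := by unfold law; infer_instance

/-- The translation of the lattice that takes the origin to `(s, y)`. -/
def shiftSite (s : ℕ) (y : ℤ) (hy : Even ((s : ℤ) + y)) (z : Site) : Site :=
  ⟨(z.1.1 + s, z.1.2 + y),
    by simpa only [add_add_add_comm] using z.2.1.add hy, add_nonneg z.2.2 s.cast_nonneg⟩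

/-- The labels as seen from the site `(s, y)`. -/
def shift (s : ℕ) (y : ℤ) (hy : Even ((s : ℤ) + y)) (U : Labels) : Labels :=
  fun z => U (shiftSite s y hy z)

/-- The reflection `(n, m) ↦ (n, -m)` of the lattice. -/
def mirrorSite (z : Site) : Site :=
  ⟨(z.1.1, -z.1.2), by simpa [Int.even_add] using z.2.1, z.2.2⟩

/-- The reflected labels. -/
def mirror (U : Labels) : Labels := fun z => U (mirrorSite z)

lemma shiftSite_injective (s : ℕ) (y : ℤ) (hy : Even ((s : ℤ) + y)) :
    Function.Injective (shiftSite s y hy) := by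
  intro a b hab
  simp only [shiftSite, Subtype.mk.injEq, Prod.mk.injEq, add_left_inj] at hab
  exact Subtype.ext (Prod.ext hab.1 hab.2)

lemma mirrorSite_involutive : Function.Involutive mirrorSite := fun z => by simp [mirrorSite]

lemma mirror_mirror (U : Labels) : mirror (mirror U) = U :=
  funext fun z => congrArg U (mirrorSite_involutive z)

lemma measurePreserving_relabel {φ : Site → Site} (hφ : Function.Injective φ) :
    MeasurePreserving (fun (U : Labels) z => U (φ z)) law law :=
  ⟨measurable_pi_lambda _ fun z => measurable_pi_apply (φ z),
    Measure.map_infinitePi_infinitePi_of_inj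
      (P := fun _ : Site => (volume : Measure unitInterval)) hφ⟩

lemma measureReal_shift_preimage {y : ℤ} (hy : Even ((s : ℤ) + y)) {E : Set Labels}
    (hE : MeasurableSet E) : law.real (shift s y hy ⁻¹' E) = law.real E :=
  (measurePreserving_relabel (shiftSite_injective s y hy)).measureReal_preimage
    hE.nullMeasurableSet

lemma measureReal_mirror_preimage {E : Set Labels} (hE : MeasurableSet E) :
    law.real (mirror ⁻¹' E) = law.real E :=
  (measurePreserving_relabel mirrorSite_involutive.injective).measureReal_preimage
    hE.nullMeasurableSet

lemma even_natCast_add_add_iff {n : ℕ} {m y : ℤ} (hy : Even ((s : ℤ) + y)) :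
    Even (((n + s : ℕ) : ℤ) + (m + y)) ↔ Even ((n : ℤ) + m) := by
  rw [Nat.cast_add, add_add_add_comm, Int.even_add (m := n + m), iff_true_right hy]

lemma occupiedAt_shift_iff {y : ℤ} (hy : Even ((s : ℤ) + y)) {n : ℕ} {m : ℤ} :
    OccupiedAt p (shift s y hy U) n m ↔ OccupiedAt p U (n + s) (m + y) := by
  have hsite (hm : Even ((n : ℤ) + m)) (hm' : Even (((n + s : ℕ) : ℤ) + (m + y))) :
      shiftSite s y hy (siteAt n m hm) = siteAt (n + s) (m + y) hm' := by
    simp [shiftSite, siteAt]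
  constructor
  · rintro ⟨hm, hlt⟩
    exact ⟨(even_natCast_add_add_iff hy).2 hm, by rwa [Occupied, ← hsite hm]⟩
  · rintro ⟨hm', hlt⟩
    have hm := (even_natCast_add_add_iff hy).1 hm'
    exact ⟨hm, by rwa [← hsite hm] at hlt⟩

lemma OccupiedAt.of_mirror {n : ℕ} {m : ℤ} (hocc : OccupiedAt p (mirror U) n m) :
    OccupiedAt p U n (-m) :=
  ⟨by simpa [Int.even_add] using hocc.1, hocc.2⟩

lemma IsPath.of_shift {y : ℤ} (hy : Even ((s : ℤ) + y)) {a b : ℕ}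
    (hh : IsPath p (shift s y hy U) h a b) :
    IsPath p U (fun n => h (n - s) + y) (a + s) (b + s) := by
  intro n hn hn'
  obtain ⟨k, rfl⟩ : ∃ k, n = k + s := ⟨n - s, by omega⟩
  simp only [Nat.add_sub_cancel, Nat.add_right_comm k s 1, ← occupiedAt_shift_iff hy,
    add_sub_add_right_eq_sub, add_left_inj]
  exact (hh k (by omega) (by omega)).imp_right (And.imp_left (even_natCast_add_add_iff hy).not.2)

lemma IsPath.to_shift {y : ℤ} (hy : Even ((s : ℤ) + y)) {a b : ℕ}
    (hh : IsPath p U h (a + s) (b + s)) :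
    IsPath p (shift s y hy U) (fun n => h (n + s) - y) a b := by
  intro n hn hn'
  simp only [occupiedAt_shift_iff, sub_add_cancel, Nat.add_right_comm n 1 s,
    sub_sub_sub_cancel_right, sub_left_inj]
  refine (hh (n + s) (by omega) (by omega)).imp_right (And.imp_left fun hodd => ?_)
  rwa [← even_natCast_add_add_iff hy, sub_add_cancel]

lemma IsPath.of_mirror (hh : IsPath p (mirror U) h s e) : IsPath p U (fun n => -h n) s e := by
  intro n hn hn'
  refine (hh n hn hn').imp (fun ⟨hocc, hstep⟩ => ⟨hocc.of_mirror, ?_⟩)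
    fun ⟨hodd, heq⟩ => ⟨?_, congrArg Neg.neg heq⟩
  · rwa [neg_sub_neg, abs_sub_comm]
  · simpa [Int.even_add] using hodd

/-- The σ-algebra generated by the labels in `S`. -/
abbrev labelSigma (S : Set Site) : MeasurableSpace Labels :=
  ⨆ z ∈ S, MeasurableSpace.comap (fun U : Labels => U z) inferInstance

lemma labelSigma_le (S : Set Site) :
    labelSigma S ≤ (inferInstance : MeasurableSpace Labels) :=
  iSup₂_le fun z _ => (measurable_pi_apply z).comap_le

lemma law_inter_of_disjoint {S T : Set Site} (hST : Disjoint S T) {A B : Set Labels}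
    (hA : MeasurableSet[labelSigma S] A) (hB : MeasurableSet[labelSigma T] B) :
    law (A ∩ B) = law A * law B := by
  have hindep : ProbabilityTheory.iIndepFun (fun (z : Site) (U : Labels) => U z) law :=
    ProbabilityTheory.iIndepFun_infinitePi
      (P := fun _ : Site => (volume : Measure unitInterval)) (X := fun _ x => x)
      (fun _ => measurable_id)
  exact (ProbabilityTheory.Indep_iff _ _ _).1 (ProbabilityTheory.indep_iSup_of_disjoint
    (fun z => (measurable_pi_apply z).comap_le) hindep hST) A B hA hB

/-! ### Events that there is a path -/

/-- There is a path over the columns `s, …, e` with the property `C`. -/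
def pathEvent (p : ℝ) (s e : ℕ) (C : (ℕ → ℤ) → Prop) : Set Labels :=
  {U | ∃ h, IsPath p U h s e ∧ C h}

lemma pathEvent_mono (hpp' : p ≤ p') {C C' : (ℕ → ℤ) → Prop} (hC : ∀ h, C h → C' h) :
    pathEvent p s e C ⊆ pathEvent p' s e C' :=
  fun _ ⟨h, hh, hCh⟩ => ⟨h, hh.mono hpp', hC h hCh⟩

lemma measurableSet_occupiedAt {S : Set Site} {n : ℕ} {m : ℤ}
    (hS : ∀ hev : Even ((n : ℤ) + m), siteAt n m hev ∈ S) :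
    MeasurableSet[labelSigma S] {U | OccupiedAt p U n m} := by
  by_cases hev : Even ((n : ℤ) + m)
  · have hpre : {U | OccupiedAt p U n m} =
        (fun U : Labels => U (siteAt n m hev)) ⁻¹' {x : unitInterval | (x : ℝ) < p} :=
      Set.ext fun U => ⟨fun hocc => hocc.2, fun hlt => ⟨hev, hlt⟩⟩
    have hle : MeasurableSpace.comap (fun U : Labels => U (siteAt n m hev)) inferInstance
        ≤ labelSigma S := le_iSup₂_of_le (siteAt n m hev) (hS hev) le_rfl
    rw [hpre]
    exact hle _ ⟨_, measurableSet_lt measurable_subtype_coe measurable_const, rfl⟩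
  · have hempty : {U | OccupiedAt p U n m} = ∅ :=
      Set.eq_empty_of_forall_notMem fun U hocc => hev hocc.even
    rw [hempty]
    exact @MeasurableSet.empty _ (labelSigma S)

lemma measurableSet_isPath {S : Set Site}
    (hS : ∀ n, s ≤ n → n < e → ∀ hev : Even ((n : ℤ) + h n), siteAt n (h n) hev ∈ S) :
    MeasurableSet[labelSigma S] {U | IsPath p U h s e} := by
  have hinter : {U | IsPath p U h s e} = ⋂ n, ⋂ (_ : s ≤ n), ⋂ (_ : n < e),
      ({U | OccupiedAt p U n (h n)} ∩ {_U | |h (n + 1) - h n| ≤ 1}) ∪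
        {_U | ¬ Even ((n : ℤ) + h n) ∧ h (n + 1) = h n} := by
    ext U
    simp [IsPath]
  rw [hinter]
  exact MeasurableSet.iInter fun n => MeasurableSet.iInter fun hn => MeasurableSet.iInter fun hn' =>
    ((measurableSet_occupiedAt (hS n hn hn')).inter (.const _)).union (.const _)

-- There are countably many height functions over the columns `s, …, e`.
lemma measurableSet_pathEvent_labelSigma {C : (ℕ → ℤ) → Prop} (hC : DependsOn C (Set.Icc s e))
    {S : Set Site}
    (hS : ∀ h, C h → ∀ n, s ≤ n → n < e → ∀ hev : Even ((n : ℤ) + h n),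
      siteAt n (h n) hev ∈ S) :
    MeasurableSet[labelSigma S] (pathEvent p s e C) := by
  let extend : (Fin (e + 1) → ℤ) → ℕ → ℤ := fun g n => if hn : n < e + 1 then g ⟨n, hn⟩ else 0
  have hunion : pathEvent p s e C =
      ⋃ g : Fin (e + 1) → ℤ, ⋃ (_ : C (extend g)), {U | IsPath p U (extend g) s e} := by
    ext U
    simp only [Set.mem_iUnion, exists_prop]
    constructor
    · rintro ⟨h, hh, hCh⟩
      have heq : ∀ n ∈ Set.Icc s e, h n = extend (fun i => h i) n := by
        intro n hn
        simp only [extend, dif_pos (Nat.lt_succ_of_le hn.2)]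
      exact ⟨fun i => h i, hC heq ▸ hCh, hh.congr fun n hn hn' => heq n ⟨hn, hn'⟩⟩
    · rintro ⟨g, hCg, hg⟩
      exact ⟨_, hg, hCg⟩
  rw [hunion]
  exact MeasurableSet.iUnion fun g => MeasurableSet.iUnion fun hCg =>
    measurableSet_isPath (hS _ hCg)

lemma measurableSet_pathEvent {C : (ℕ → ℤ) → Prop} (hC : DependsOn C (Set.Icc s e)) :
    MeasurableSet (pathEvent p s e C) :=
  labelSigma_le Set.univ _
    (measurableSet_pathEvent_labelSigma hC fun _ _ _ _ _ _ => Set.mem_univ _)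

lemma dependsOn_ends (hse : s ≤ e) (P : ℤ → ℤ → Prop) :
    DependsOn (fun h : ℕ → ℤ => P (h s) (h e)) (Set.Icc s e) := fun f g hfg => by
  dsimp only
  rw [hfg s ⟨le_rfl, hse⟩, hfg e ⟨hse, le_rfl⟩]

/-! ### The upper edge -/

/-- The upper edge at level `n` is at least `x`. -/
def edgeGE (p : ℝ) (n : ℕ) (x : ℤ) : Set Labels :=
  pathEvent p 0 n fun h => h 0 ≤ 0 ∧ x ≤ h n

lemma measurableSet_edgeGE (p : ℝ) (n : ℕ) (x : ℤ) : MeasurableSet (edgeGE p n x) :=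
  measurableSet_pathEvent (dependsOn_ends n.zero_le fun y z => y ≤ 0 ∧ x ≤ z)

lemma edgeGE_subset_edgeGE (hpp' : p ≤ p') {n : ℕ} {x x' : ℤ} (hx : x ≤ x') :
    edgeGE p n x' ⊆ edgeGE p' n x :=
  pathEvent_mono hpp' fun _ => And.imp_right hx.trans

lemma le_of_mem_edgeGE {n : ℕ} {x : ℤ} (hU : U ∈ edgeGE p n x) : x ≤ n := by
  obtain ⟨h, hh, h0, hx⟩ := hU
  have hdist := (le_abs_self _).trans (hh.abs_sub_le le_rfl n.zero_le le_rfl)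
  push_cast at hdist
  linarith

lemma exists_forall_mem_edgeGE_iff {n : ℕ} (hU : ∃ x, U ∈ edgeGE p n x) :
    ∃ m : ℤ, ∀ x, U ∈ edgeGE p n x ↔ x ≤ m := by
  obtain ⟨m, hm, hmax⟩ := Int.exists_greatest_of_bdd ⟨n, fun x hx => le_of_mem_edgeGE hx⟩ hU
  exact ⟨m, fun x => ⟨hmax x, fun hx => edgeGE_subset_edgeGE le_rfl hx hm⟩⟩

-- A path that stops in the middle of an arrow of length two is redirected to a diagonal arrow.
lemma exists_path_of_mem_edgeGE {n : ℕ} (hn : 1 ≤ n) {x : ℤ} (hU : U ∈ edgeGE p n x) :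
    ∃ h, IsPath p U h 0 n ∧ h 0 ≤ 0 ∧ x ≤ h n ∧ Even ((n : ℤ) + h n) := by
  obtain ⟨h, hh, h0, hx⟩ := hU
  by_cases heven : Even ((n : ℤ) + h n)
  · exact ⟨h, hh, h0, hx, heven⟩
  obtain ⟨k, rfl⟩ : ∃ k, n = k + 1 := ⟨n - 1, by omega⟩
  rw [Int.even_iff] at heven
  push_cast at heven
  obtain ⟨hocc, hlevel⟩ : OccupiedAt p U k (h k) ∧ h (k + 1) = h k := by
    rcases hh k k.zero_le k.lt_succ_self with ⟨hocc, hstep⟩ | ⟨hodd, hlevel⟩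
    · have hk := Int.even_iff.1 hocc.even
      rw [abs_le] at hstep
      exact ⟨hocc, by omega⟩
    · rw [Int.even_iff] at hodd
      omega
  refine ⟨Function.update h (k + 1) (h k + 1), fun m hm hm' => ?_, ?_, ?_, ?_⟩
  · rw [Function.update_of_ne (by omega)]
    obtain hmk | rfl : m < k ∨ m = k := by omega
    · rw [Function.update_of_ne (by omega)]
      exact hh m hm hm'
    · rw [Function.update_self]
      exact Or.inl ⟨hocc, by simp⟩
  · rwa [Function.update_of_ne (by omega)]
  · rw [Function.update_self]
    omega
  · rw [Function.update_self, Int.even_iff]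
    push_cast
    omega

lemma mem_edgeGE_of_mem_reachedFromBelow {n : ℕ} {x : ℤ} (hx : x ∈ reachedFromBelow p U n) :
    U ∈ edgeGE p n x := by
  obtain ⟨a, b, ha, ha', hb, hab⟩ := hx
  obtain ⟨hle, h, hh, -, hha, hhb⟩ := hab.reach
  simp only [hb, Int.toNat_natCast] at hle hh hhb
  rcases ha with ha | ha <;> simp only [ha, Int.toNat_zero, Int.toNat_one] at hle hh hha
  · exact ⟨h, hh, hha.trans_le ha', hhb.ge⟩
  · refine ⟨fun k => h (max k 1), fun k hk hk' => ?_, by simpa [hha] using ha', ?_⟩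
    · obtain rfl | hk1 : k = 0 ∨ 1 ≤ k := by omega
      · have heven := a.2.1
        rw [ha, ← hha, Int.even_iff] at heven
        refine Or.inr ⟨?_, by simp⟩
        simp only [max_eq_right zero_le_one, Int.even_iff, Nat.cast_zero]
        omega
      · simpa only [max_eq_left hk1, max_eq_left (hk1.trans k.le_succ)] using hh k hk1 hk'
    · simp only [max_eq_left hle, hhb, le_refl]

lemma exists_mem_reachedFromBelow {n : ℕ} (hn : 1 ≤ n) {x : ℤ} (hU : U ∈ edgeGE p n x) :
    ∃ y ∈ reachedFromBelow p U n, x ≤ y := by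
  obtain ⟨h, hh, h0, hx, heven⟩ := exists_path_of_mem_edgeGE hn hU
  refine ⟨h n, ?_, hx⟩
  rcases hh 0 le_rfl hn with ⟨hocc, -⟩ | ⟨hodd, hlevel⟩
  · exact ⟨_, _, Or.inl rfl, h0, rfl, hh.connected n.zero_le hocc.even heven⟩
  · have heven1 : Even (((1 : ℕ) : ℤ) + h 1) := by
      rw [Int.even_iff] at hodd ⊢
      push_cast at *
      omega
    exact ⟨_, _, Or.inr rfl, hlevel.trans_le h0, rfl,
      (hh.sub zero_le_one le_rfl).connected hn heven1 heven⟩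

lemma upperEdge_eq_bot {n : ℕ} (hU : ∀ x, U ∉ edgeGE p n x) : upperEdge p U n = ⊥ :=
  iSup₂_eq_bot.2 fun x hx => absurd (mem_edgeGE_of_mem_reachedFromBelow hx) (hU x)

lemma upperEdge_eq_intCast {n : ℕ} (hn : 1 ≤ n) {m : ℤ}
    (hU : ∀ x, U ∈ edgeGE p n x ↔ x ≤ m) : upperEdge p U n = ((m : ℝ) : EReal) := by
  apply le_antisymm
  · refine iSup₂_le fun x hx => ?_
    exact_mod_cast (hU x).1 (mem_edgeGE_of_mem_reachedFromBelow hx)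
  · obtain ⟨y, hy, hmy⟩ := exists_mem_reachedFromBelow hn ((hU m).2 le_rfl)
    refine le_iSup₂_of_le y hy ?_
    exact_mod_cast hmy

/-- The upper edge, truncated below at `-K`, as a sum of indicators of `edgeGE`. -/
def truncEdge (p : ℝ) (n K : ℕ) (U : Labels) : ℝ :=
  -K + ∑ x ∈ Finset.Ioc (-(K : ℤ)) n, (edgeGE p n x).indicator 1 U

lemma truncEdge_eq_neg {n K : ℕ} (hU : ∀ x, U ∉ edgeGE p n x) : truncEdge p n K U = -K := by
  rw [truncEdge, Finset.sum_eq_zero fun x _ => Set.indicator_of_notMem (hU x) _, add_zero]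

lemma truncEdge_eq_max {n K : ℕ} {m : ℤ} (hU : ∀ x, U ∈ edgeGE p n x ↔ x ≤ m) :
    truncEdge p n K U = max (m : ℝ) (-K) := by
  have hm : m ≤ n := le_of_mem_edgeGE ((hU m).2 le_rfl)
  have hfilter : (Finset.Ioc (-(K : ℤ)) n).filter (· ≤ m) = Finset.Ioc (-(K : ℤ)) m := by
    ext x
    simp only [Finset.mem_filter, Finset.mem_Ioc]
    omega
  have hsum : ∑ x ∈ Finset.Ioc (-(K : ℤ)) n, (edgeGE p n x).indicator (1 : Labels → ℝ) U =
      ((m + K).toNat : ℝ) := by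
    classical
    simp only [Set.indicator_apply, hU, Pi.one_apply, Finset.sum_boole, hfilter, Int.card_Ioc,
      sub_neg_eq_add]
  have hcast : (((m + K).toNat : ℤ) : ℝ) = max ((m : ℝ) + K) 0 := by
    rw [Int.toNat_eq_max]
    push_cast
    rfl
  rw [truncEdge, hsum, ← Int.cast_natCast (m + K).toNat, hcast, ← max_add_add_left]
  simp

lemma coe_truncEdge {n : ℕ} (hn : 1 ≤ n) (K : ℕ) :
    (truncEdge p n K U : EReal) = max (upperEdge p U n) ((-K : ℝ) : EReal) := by
  by_cases hU : ∃ x, U ∈ edgeGE p n x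
  · obtain ⟨m, hm⟩ := exists_forall_mem_edgeGE_iff hU
    rw [truncEdge_eq_max hm, upperEdge_eq_intCast hn hm, EReal.coe_strictMono.monotone.map_max]
  · push Not at hU
    rw [truncEdge_eq_neg hU, upperEdge_eq_bot hU, bot_sup_eq]

lemma neg_le_truncEdge (p : ℝ) (n K : ℕ) (U : Labels) : -(K : ℝ) ≤ truncEdge p n K U :=
  le_add_of_nonneg_right (Finset.sum_nonneg fun _ _ => Set.indicator_nonneg (by simp) _)

lemma truncEdge_le (p : ℝ) (n K : ℕ) (U : Labels) : truncEdge p n K U ≤ n := by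
  have hK : -(K : ℝ) ≤ n := (neg_nonpos.2 K.cast_nonneg).trans n.cast_nonneg
  by_cases hU : ∃ x, U ∈ edgeGE p n x
  · obtain ⟨m, hm⟩ := exists_forall_mem_edgeGE_iff hU
    rw [truncEdge_eq_max hm]
    exact max_le (by exact_mod_cast le_of_mem_edgeGE ((hm m).2 le_rfl)) hK
  · push Not at hU
    rwa [truncEdge_eq_neg hU]

lemma le_truncEdge_of_mem_edgeGE {n : ℕ} (K : ℕ) {x : ℤ} (hx : U ∈ edgeGE p n x) :
    (x : ℝ) ≤ truncEdge p n K U := by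
  obtain ⟨m, hm⟩ := exists_forall_mem_edgeGE_iff ⟨x, hx⟩
  rw [truncEdge_eq_max hm]
  exact le_max_of_le_left (by exact_mod_cast (hm x).1 hx)

lemma truncEdge_mono (hpp' : p ≤ p') (n K : ℕ) (U : Labels) :
    truncEdge p n K U ≤ truncEdge p' n K U := by
  unfold truncEdge
  refine add_le_add_right (Finset.sum_le_sum fun x _ => ?_) _
  exact Set.indicator_le_indicator_apply_of_subset (edgeGE_subset_edgeGE hpp' le_rfl)
    (show 0 ≤ (1 : Labels → ℝ) U from zero_le_one' ℝ)

lemma antitone_truncEdge {n : ℕ} (hn : 1 ≤ n) : Antitone (truncEdge p n) := by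
  intro K K' hK U
  rw [← EReal.coe_le_coe_iff, coe_truncEdge hn, coe_truncEdge hn]
  exact max_le_max le_rfl (EReal.coe_le_coe_iff.2 (neg_le_neg (by exact_mod_cast hK)))

lemma measurable_truncEdge (p : ℝ) (n K : ℕ) : Measurable (truncEdge p n K) :=
  measurable_const.add (Finset.measurable_sum _ fun x _ =>
    measurable_one.indicator (measurableSet_edgeGE p n x))

lemma integrable_truncEdge (p : ℝ) (n K : ℕ) : Integrable (truncEdge p n K) law :=
  .of_mem_Icc (-K) n (measurable_truncEdge p n K).aemeasurable
    (.of_forall fun U => ⟨neg_le_truncEdge p n K U, truncEdge_le p n K U⟩)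

lemma integral_truncEdge (p : ℝ) (n K : ℕ) : ∫ U, truncEdge p n K U ∂law =
    -K + ∑ x ∈ Finset.Ioc (-(K : ℤ)) n, law.real (edgeGE p n x) := by
  have hint : ∀ x ∈ Finset.Ioc (-(K : ℤ)) n,
      Integrable ((edgeGE p n x).indicator (1 : Labels → ℝ)) law := fun x _ =>
    (integrable_const (1 : ℝ)).indicator (measurableSet_edgeGE p n x)
  unfold truncEdge
  rw [integral_add (integrable_const _) (integrable_finsetSum _ hint),
    integral_finsetSum _ hint]
  simp [integral_indicator_one, measurableSet_edgeGE]

/-! ### The edge speed as an infimum of integrals -/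

lemma expectation_eq_iInf_integral {X : Labels → EReal} {Y : ℕ → Labels → ℝ}
    (hY : ∀ K, Integrable (Y K) law) (hanti : Antitone Y)
    (hX : ∀ U, X U = ⨅ K, (Y K U : EReal)) :
    expectation X = ⨅ K, ((∫ U, Y K U ∂law : ℝ) : EReal) := by
  have hlim (U : Labels) : Tendsto (fun K => (Y K U : EReal)) atTop (𝓝 (X U)) := by
    rw [hX U]
    exact tendsto_atTop_iInf fun K K' hK => EReal.coe_le_coe_iff.2 (hanti hK U)
  have hpos : Tendsto (fun K => ∫⁻ U, ENNReal.ofReal (Y K U) ∂law) atTop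
      (𝓝 (∫⁻ U, (X U).toENNReal ∂law)) :=
    lintegral_tendsto_of_tendsto_of_antitone (fun K => (hY K).aemeasurable.ennreal_ofReal)
      (.of_forall fun U K K' hK => ENNReal.ofReal_le_ofReal (hanti hK U))
      (hY 0).lintegral_lt_top.ne
      (.of_forall fun U => (EReal.continuous_toENNReal.tendsto _).comp (hlim U))
  have hneg : Tendsto (fun K => ∫⁻ U, ENNReal.ofReal (-Y K U) ∂law) atTop
      (𝓝 (∫⁻ U, (-X U).toENNReal ∂law)) :=
    lintegral_tendsto_of_tendsto_of_monotone (fun K => (hY K).neg.aemeasurable.ennreal_ofReal)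
      (.of_forall fun U K K' hK => ENNReal.ofReal_le_ofReal (neg_le_neg (hanti hK U)))
      (.of_forall fun U =>
        ((EReal.continuous_toENNReal.comp continuous_neg).tendsto _).comp (hlim U))
  have hfinite : ∫⁻ U, (X U).toENNReal ∂law ≠ ⊤ :=
    ((le_of_tendsto' hpos fun K => lintegral_mono fun U =>
      ENNReal.ofReal_le_ofReal (hanti K.zero_le U)).trans_lt (hY 0).lintegral_lt_top).ne
  have hsub (K : ℕ) : ((∫ U, Y K U ∂law : ℝ) : EReal) =
      ((∫⁻ U, ENNReal.ofReal (Y K U) ∂law : ENNReal) : EReal) -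
        ((∫⁻ U, ENNReal.ofReal (-Y K U) ∂law : ENNReal) : EReal) := by
    have hneg_lt : ∫⁻ U, ENNReal.ofReal (-Y K U) ∂law < ⊤ := (hY K).neg.lintegral_lt_top
    rw [integral_eq_lintegral_pos_part_sub_lintegral_neg_part (hY K), EReal.coe_sub,
      EReal.coe_ennreal_toReal (hY K).lintegral_lt_top.ne,
      EReal.coe_ennreal_toReal hneg_lt.ne]
  refine tendsto_nhds_unique ?_ (tendsto_atTop_iInf fun K K' hK =>
    EReal.coe_le_coe_iff.2 (integral_mono (hY K') (hY K) (hanti hK)))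
  simp only [hsub, sub_eq_add_neg]
  have hcont := EReal.continuousAt_add
    (p := (((∫⁻ U, (X U).toENNReal ∂law : ENNReal) : EReal),
      -((∫⁻ U, (-X U).toENNReal ∂law : ENNReal) : EReal)))
    (Or.inl (by simpa using hfinite)) (Or.inl (EReal.coe_ennreal_ne_bot _))
  exact hcont.tendsto.comp (((continuous_coe_ennreal_ereal.tendsto _).comp hpos).prodMk_nhds
    (((continuous_coe_ennreal_ereal.tendsto _).comp hneg).neg))

lemma upperEdge_div_eq_iInf {n : ℕ} (hn : 1 ≤ n) :
    upperEdge p U n / (n : EReal) = ⨅ K : ℕ, ((truncEdge p n K U / n : ℝ) : EReal) := by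
  have hn0 : (0 : EReal) < n := by exact_mod_cast hn
  have hntop := EReal.natCast_ne_top n
  refine eq_of_forall_le_iff fun c => ?_
  simp only [le_iInf_iff, EReal.coe_div, EReal.coe_natCast, EReal.le_div_iff_mul_le hn0 hntop,
    coe_truncEdge hn]
  have hbot : ⨅ K : ℕ, ((-K : ℝ) : EReal) = ⊥ := by
    refine EReal.eq_bot_iff_forall_lt _ |>.2 fun y => ?_
    obtain ⟨K, hK⟩ := exists_nat_gt (-y)
    exact (iInf_le _ K).trans_lt (EReal.coe_lt_coe_iff.2 (neg_lt.1 hK))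
  rw [← le_iInf_iff, ← sup_iInf_eq, hbot, sup_bot_eq]

lemma edgeSpeed_eq_iInf (p : ℝ) :
    edgeSpeed p = ⨅ (n : ℕ) (_ : 1 ≤ n) (K : ℕ),
      (((∫ U, truncEdge p n K U ∂law) / n : ℝ) : EReal) := by
  refine iInf_congr fun n => iInf_congr fun hn => ?_
  simp only [← integral_div]
  exact expectation_eq_iInf_integral (fun K => (integrable_truncEdge p n K).div_const _)
    (fun K K' hK U => div_le_div_of_nonneg_right (antitone_truncEdge hn hK U) n.cast_nonneg)
    fun U => upperEdge_div_eq_iInf hn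

lemma edgeSpeed_le_integral_truncEdge {n : ℕ} (hn : 1 ≤ n) (K : ℕ) :
    edgeSpeed p ≤ (((∫ U, truncEdge p n K U ∂law) / n : ℝ) : EReal) := by
  rw [edgeSpeed_eq_iInf]
  exact iInf₂_le_of_le n hn (iInf_le _ K)

lemma exists_integral_truncEdge_lt {c : ℝ} (hc : edgeSpeed p < (c : EReal)) :
    ∃ n, 1 ≤ n ∧ ∃ K : ℕ, ∫ U, truncEdge p n K U ∂law < c * n := by
  simp only [edgeSpeed_eq_iInf, iInf_lt_iff, EReal.coe_lt_coe_iff] at hc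
  obtain ⟨n, hn, K, hK⟩ := hc
  exact ⟨n, hn, K, (div_lt_iff₀ (by exact_mod_cast hn)).1 hK⟩

lemma edgeSpeed_le_one (p : ℝ) : edgeSpeed p ≤ 1 := by
  refine (edgeSpeed_le_integral_truncEdge le_rfl 0).trans ?_
  have hle := integral_mono (integrable_truncEdge p 1 0) (integrable_const _) (truncEdge_le p 1 0)
  rw [integral_const, probReal_univ, one_smul] at hle
  rw [← EReal.coe_one, EReal.coe_le_coe_iff]
  simpa using hle

lemma edgeSpeed_mono (hpp' : p ≤ p') : edgeSpeed p ≤ edgeSpeed p' := by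
  simp only [edgeSpeed_eq_iInf]
  gcongr with n hn K
  · exact integrable_truncEdge p n K
  · exact integrable_truncEdge p' n K
  · exact truncEdge_mono hpp' n K

/-! ### Subadditivity and the upper tail of the edge -/

/-- The upper edge at level `n` equals `j`. -/
def edgeEQ (p : ℝ) (n : ℕ) (j : ℤ) : Set Labels := edgeGE p n j \ edgeGE p n (j + 1)

/-- The exponential moment of order `θ` of the upper edge at level `n`; the value `-∞` of the
edge contributes `0`. -/
def edgeMoment (p : ℝ) (n : ℕ) (θ : ℝ) : ENNReal :=
  ∑' j : ℤ, law (edgeEQ p n j) * ENNReal.ofReal (Real.exp (θ * j))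

lemma measurableSet_edgeGE_labelSigma (p : ℝ) (n : ℕ) (x : ℤ) :
    MeasurableSet[labelSigma {z : Site | z.1.1 < n}] (edgeGE p n x) :=
  measurableSet_pathEvent_labelSigma (dependsOn_ends n.zero_le fun y z => y ≤ 0 ∧ x ≤ z)
    fun _ _ _ _ hk _ => by simpa [siteAt] using hk

lemma measurableSet_edgeEQ_labelSigma (p : ℝ) (n : ℕ) (j : ℤ) :
    MeasurableSet[labelSigma {z : Site | z.1.1 < n}] (edgeEQ p n j) :=
  @MeasurableSet.diff _ (labelSigma _) _ _ (measurableSet_edgeGE_labelSigma p n j)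
    (measurableSet_edgeGE_labelSigma p n (j + 1))

lemma mem_edgeEQ_iff {n : ℕ} {m : ℤ} (hm : ∀ x, U ∈ edgeGE p n x ↔ x ≤ m) (j : ℤ) :
    U ∈ edgeEQ p n j ↔ j = m := by
  simp only [edgeEQ, Set.mem_sdiff, hm]
  omega

lemma even_of_mem_edgeEQ {n : ℕ} (hn : 1 ≤ n) {j : ℤ} (hU : U ∈ edgeEQ p n j) :
    Even ((n : ℤ) + j) := by
  obtain ⟨h, hh, h0, hj, heven⟩ := exists_path_of_mem_edgeGE hn hU.1
  have hlt : ¬ j + 1 ≤ h n := fun hlt => hU.2 ⟨h, hh, h0, hlt⟩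
  rwa [show j = h n by omega]

lemma edgeGE_add_subset (p : ℝ) (n r : ℕ) (x : ℤ) :
    edgeGE p (n + r) x ⊆
      ⋃ j, edgeEQ p n j ∩ pathEvent p n (n + r) fun h => h n ≤ j ∧ x ≤ h (n + r) := by
  rintro U ⟨h, hh, h0, hx⟩
  have hn : U ∈ edgeGE p n (h n) := ⟨h, hh.sub le_rfl (n.le_add_right r), h0, le_rfl⟩
  obtain ⟨m, hm⟩ := exists_forall_mem_edgeGE_iff ⟨_, hn⟩
  exact Set.mem_iUnion.2 ⟨m, (mem_edgeEQ_iff hm m).2 rfl, h, hh.sub n.zero_le le_rfl,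
    (hm _).1 hn, hx⟩

lemma pathEvent_subset_shift_preimage_edgeGE {y : ℤ} (hy : Even ((s : ℤ) + y)) (r : ℕ) (x : ℤ) :
    pathEvent p s (s + r) (fun h => h s ≤ y ∧ x ≤ h (s + r)) ⊆
      shift s y hy ⁻¹' edgeGE p r (x - y) := by
  rintro U ⟨h, hh, hs, hx⟩
  refine ⟨fun k => h (k + s) - y, IsPath.to_shift hy ?_, by simpa using hs, ?_⟩
  · rwa [zero_add, add_comm r s]
  · simpa only [add_comm r s] using sub_le_sub_right hx y

lemma law_edgeGE_add_le {n : ℕ} (hn : 1 ≤ n) (r : ℕ) (x : ℤ) :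
    law (edgeGE p (n + r) x) ≤ ∑' j : ℤ, law (edgeEQ p n j) * law (edgeGE p r (x - j)) := by
  refine (measure_mono (edgeGE_add_subset p n r x)).trans
    ((measure_iUnion_le _).trans (ENNReal.tsum_le_tsum fun j => ?_))
  by_cases hj : Even ((n : ℤ) + j)
  · have hright : MeasurableSet[labelSigma {z : Site | (n : ℤ) ≤ z.1.1}]
        (pathEvent p n (n + r) fun h => h n ≤ j ∧ x ≤ h (n + r)) :=
      measurableSet_pathEvent_labelSigma (dependsOn_ends (n.le_add_right r)
        fun y z => y ≤ j ∧ x ≤ z) fun _ _ _ hk _ _ => by simpa [siteAt] using hk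
    have hdisj : Disjoint {z : Site | z.1.1 < n} {z : Site | (n : ℤ) ≤ z.1.1} :=
      Set.disjoint_left.2 fun z hlt hle => not_lt.2 (Set.mem_ofPred.1 hle) hlt
    rw [law_inter_of_disjoint hdisj (measurableSet_edgeEQ_labelSigma p n j) hright]
    refine mul_le_mul_right ((measure_mono
      (pathEvent_subset_shift_preimage_edgeGE hj r x)).trans_eq ?_) _
    exact (measurePreserving_relabel (shiftSite_injective n j hj)).measure_preimage
      (measurableSet_edgeGE p r (x - j)).nullMeasurableSet
  · have hempty : edgeEQ p n j = ∅ :=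
      Set.eq_empty_of_forall_notMem fun U hU => hj (even_of_mem_edgeEQ hn hU)
    simp [hempty]

lemma law_edgeGE_le_exp {θ : ℝ} (hθ : 0 ≤ θ) (n : ℕ) (x : ℤ) :
    law (edgeGE p n x) ≤ ENNReal.ofReal (Real.exp (θ * (n - x))) := by
  by_cases hx : x ≤ n
  · have hx' : (0 : ℝ) ≤ n - x := sub_nonneg.2 (by exact_mod_cast hx)
    calc law (edgeGE p n x) ≤ ENNReal.ofReal 1 := ENNReal.ofReal_one ▸ prob_le_one
      _ ≤ _ := ENNReal.ofReal_le_ofReal (Real.one_le_exp (mul_nonneg hθ hx'))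
  · have hempty : edgeGE p n x = ∅ :=
      Set.eq_empty_of_forall_notMem fun U hU => hx (le_of_mem_edgeGE hU)
    simp [hempty]

lemma law_edgeGE_mul_add_le {n : ℕ} (hn : 1 ≤ n) {θ : ℝ} (hθ : 0 ≤ θ) (k r : ℕ) (x : ℤ) :
    law (edgeGE p (k * n + r) x) ≤
      edgeMoment p n θ ^ k * ENNReal.ofReal (Real.exp (θ * (r - x))) := by
  induction k generalizing x with
  | zero => simpa using law_edgeGE_le_exp hθ r x
  | succ k ih =>
    rw [show (k + 1) * n + r = n + (k * n + r) by ring, pow_succ', mul_assoc, edgeMoment,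
      ← ENNReal.tsum_mul_right]
    refine (law_edgeGE_add_le hn _ x).trans (ENNReal.tsum_le_tsum fun j => ?_)
    rw [mul_assoc]
    refine mul_le_mul_right ((ih (x - j)).trans_eq ?_) _
    rw [mul_left_comm, ← ENNReal.ofReal_mul (Real.exp_pos _).le, ← Real.exp_add]
    congr 3
    push_cast
    ring

lemma edgeMoment_le_mgf (p : ℝ) (n K : ℕ) {θ : ℝ} (hθ : 0 ≤ θ) :
    edgeMoment p n θ ≤ ENNReal.ofReal (ProbabilityTheory.mgf (truncEdge p n K) law θ) := by
  have hmeas (j : ℤ) : MeasurableSet (edgeEQ p n j) :=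
    labelSigma_le _ _ (measurableSet_edgeEQ_labelSigma p n j)
  have hterm (j : ℤ) : law (edgeEQ p n j) * ENNReal.ofReal (Real.exp (θ * j)) =
      ∫⁻ U, (edgeEQ p n j).indicator (fun _ => ENNReal.ofReal (Real.exp (θ * j))) U ∂law := by
    rw [lintegral_indicator_const (hmeas j), mul_comm]
  have hint : Integrable (fun U => Real.exp (θ * truncEdge p n K U)) law :=
    ProbabilityTheory.integrable_exp_mul_of_mem_Icc (measurable_truncEdge p n K).aemeasurable
      (.of_forall fun U => ⟨neg_le_truncEdge p n K U, truncEdge_le p n K U⟩)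
  simp_rw [edgeMoment, hterm, ProbabilityTheory.mgf]
  rw [← lintegral_tsum fun j => (measurable_const.indicator (hmeas j)).aemeasurable,
    ofReal_integral_eq_lintegral_ofReal hint (.of_forall fun U => (Real.exp_pos _).le)]
  refine lintegral_mono fun U => ?_
  by_cases hU : ∃ x, U ∈ edgeGE p n x
  · obtain ⟨m, hm⟩ := exists_forall_mem_edgeGE_iff hU
    rw [tsum_eq_single m fun j hj =>
        Set.indicator_of_notMem (fun hj' => hj ((mem_edgeEQ_iff hm j).1 hj')) _,
      Set.indicator_of_mem ((mem_edgeEQ_iff hm m).2 rfl)]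
    gcongr
    exact le_truncEdge_of_mem_edgeGE K ((hm m).2 le_rfl)
  · push Not at hU
    rw [ENNReal.tsum_eq_zero.2 fun j => Set.indicator_of_notMem (fun hj => hU j hj.1) _]
    exact zero_le

lemma exists_edgeMoment_le {b : ℝ} (hb : edgeSpeed p < (b : EReal)) :
    ∃ n, 1 ≤ n ∧ ∃ θ : ℝ, 0 < θ ∧ ∃ ρ : ℝ, 0 ≤ ρ ∧ ρ < 1 ∧
      edgeMoment p n θ ≤ ENNReal.ofReal (ρ * Real.exp (θ * (b * n))) := by
  obtain ⟨n, hn, K, hK⟩ := exists_integral_truncEdge_lt hb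
  have hexp (θ : ℝ) : Integrable (fun U => Real.exp (θ * (truncEdge p n K U + -(b * n)))) law :=
    ProbabilityTheory.integrable_exp_mul_of_mem_Icc
      (a := -K + -(b * n)) (b := n + -(b * n))
      ((measurable_truncEdge p n K).add_const _).aemeasurable
      (.of_forall fun U => ⟨add_le_add_left (neg_le_truncEdge p n K U) _,
        add_le_add_left (truncEdge_le p n K U) _⟩)
  have hneg : ∫ U, (truncEdge p n K U + -(b * n)) ∂law < 0 := by
    rw [integral_add (integrable_truncEdge p n K) (integrable_const _)]
    simpa using hK
  obtain ⟨θ, hθ, hlt⟩ := exists_pos_mgf_lt_one (by simp [ProbabilityTheory.integrableExpSet, hexp])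
    hneg
  refine ⟨n, hn, θ, hθ, _, ProbabilityTheory.mgf_nonneg, hlt,
    (edgeMoment_le_mgf p n K hθ.le).trans_eq ?_⟩
  rw [ProbabilityTheory.mgf_add_const, mul_assoc, ← Real.exp_add, mul_neg, neg_add_cancel,
    Real.exp_zero, mul_one]

lemma tendsto_edgeGE_of_edgeSpeed_lt {b : ℝ} (hb : edgeSpeed p < (b : EReal)) :
    Tendsto (fun m : ℕ => law.real (edgeGE p m ⌈b * m⌉)) atTop (𝓝 0) := by
  obtain ⟨n, hn, θ, hθ, ρ, hρ0, hρ1, hmoment⟩ := exists_edgeMoment_le hb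
  have hbound (m : ℕ) : law.real (edgeGE p m ⌈b * m⌉) ≤
      ρ ^ (m / n) * Real.exp (θ * (n * |1 - b|)) := by
    set k := m / n
    set r := m % n
    have hm : k * n + r = m := Nat.div_add_mod' m n
    have hle : law (edgeGE p m ⌈b * m⌉) ≤ ENNReal.ofReal
        ((ρ * Real.exp (θ * (b * n))) ^ k * Real.exp (θ * (r - ⌈b * m⌉))) := by
      rw [ENNReal.ofReal_mul (by positivity), ENNReal.ofReal_pow (by positivity)]
      calc law (edgeGE p m ⌈b * m⌉)
          ≤ edgeMoment p n θ ^ k * ENNReal.ofReal (Real.exp (θ * (r - ⌈b * m⌉))) := by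
            simpa only [hm] using law_edgeGE_mul_add_le (p := p) hn hθ.le k r ⌈b * m⌉
        _ ≤ _ := by gcongr
    refine (ENNReal.toReal_le_of_le_ofReal (by positivity) hle).trans ?_
    rw [mul_pow, mul_assoc, ← Real.exp_nat_mul, ← Real.exp_add]
    gcongr
    have hr : (r : ℝ) ≤ n := by exact_mod_cast (Nat.mod_lt m hn).le
    have hmr : (m : ℝ) = k * n + r := by exact_mod_cast hm.symm
    calc (k : ℝ) * (θ * (b * n)) + θ * (r - ⌈b * m⌉)
        ≤ k * (θ * (b * n)) + θ * (r - b * m) := by gcongr; exact Int.le_ceil _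
      _ = θ * (r * (1 - b)) := by rw [hmr]; ring
      _ ≤ θ * (r * |1 - b|) := by gcongr; exact le_abs_self _
      _ ≤ θ * (n * |1 - b|) := by gcongr
  have hlim := ((tendsto_pow_atTop_nhds_zero_of_lt_one hρ0 hρ1).comp
    (Nat.tendsto_div_const_atTop (by omega : n ≠ 0))).mul_const (Real.exp (θ * (n * |1 - b|)))
  rw [zero_mul] at hlim
  exact squeeze_zero (fun m => measureReal_nonneg) hbound hlim

/-! ### Percolation -/

lemma IsPath.even_or_even_succ (hh : IsPath p U h s e) {n : ℕ} (hs : s ≤ n) (he : n < e) :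
    Even ((n : ℤ) + h n) ∨ Even (((n + 1 : ℕ) : ℤ) + h (n + 1)) := by
  rcases hh n hs he with ⟨hocc, -⟩ | ⟨hodd, hlevel⟩
  · exact Or.inl hocc.even
  · rw [Int.even_iff] at hodd
    refine Or.inr (Int.even_iff.2 ?_)
    push_cast
    omega

lemma mem_pathEvent_of_infinite_cluster (hinf : (cluster p U).Infinite) (n : ℕ) :
    U ∈ pathEvent p 0 n fun h => h 0 = 0 := by
  by_contra hno
  have hbox : cluster p U ⊆ Subtype.val ⁻¹' Set.Icc ((0 : ℤ), -(n : ℤ)) ((n : ℤ), (n : ℤ)) := by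
    intro b hb
    obtain ⟨-, h, hh, -, h0, hend⟩ := hb.reach
    replace hh : IsPath p U h 0 b.1.1.toNat := hh
    replace h0 : h 0 = 0 := h0
    have hcol : b.1.1.toNat < n := by
      by_contra! hle
      exact hno ⟨h, hh.sub le_rfl hle, h0⟩
    have hdist := hh.abs_sub_le le_rfl (Nat.zero_le _) le_rfl
    rw [h0, hend, abs_le, natCast_toNat_fst] at hdist
    have hcast := natCast_toNat_fst b
    push_cast at hdist
    exact ⟨⟨b.2.2, by dsimp only; omega⟩, by dsimp only; omega, by dsimp only; omega⟩
  exact hinf (((Set.finite_Icc _ _).preimage Subtype.val_injective.injOn).subset hbox)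

lemma exists_mem_cluster_of_mem_pathEvent {n : ℕ}
    (hU : U ∈ pathEvent p 0 (n + 1) fun h => h 0 = 0) :
    ∃ b ∈ cluster p U, (n : ℤ) ≤ b.1.1 := by
  obtain ⟨h, hh, h0⟩ := hU
  have heven0 : Even (((0 : ℕ) : ℤ) + h 0) := by simp [h0]
  have horigin : siteAt 0 (h 0) heven0 = origin := by simp [siteAt, origin, h0]
  obtain ⟨k, hnk, hk, heven⟩ : ∃ k, n ≤ k ∧ k ≤ n + 1 ∧ Even ((k : ℤ) + h k) :=
    (hh.even_or_even_succ n.zero_le n.lt_succ_self).elim (fun hn => ⟨n, le_rfl, n.le_succ, hn⟩)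
      fun hn => ⟨n + 1, n.le_succ, le_rfl, hn⟩
  refine ⟨siteAt k (h k) heven, ?_, Int.ofNat_le.2 hnk⟩
  rw [cluster, ← horigin]
  exact (hh.sub le_rfl hk).connected k.zero_le heven0 heven

lemma infinite_cluster_iff :
    (cluster p U).Infinite ↔ ∀ n, U ∈ pathEvent p 0 n fun h => h 0 = 0 := by
  refine ⟨mem_pathEvent_of_infinite_cluster, fun hpath => Set.Infinite.of_image (fun b => b.1.1) ?_⟩
  refine Set.infinite_of_forall_exists_gt fun N => ?_
  obtain ⟨b, hb, hcol⟩ := exists_mem_cluster_of_mem_pathEvent (hpath ((N + 1).toNat + 1))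
  exact ⟨b.1.1, ⟨b, hb, rfl⟩, by omega⟩

lemma percolationProb_mono (hpp' : p ≤ p') : percolationProb p ≤ percolationProb p' :=
  measure_mono fun _ hU => infinite_cluster_iff.2 fun n =>
    pathEvent_mono hpp' (fun _ => id) (infinite_cluster_iff.1 hU n)

lemma pos_of_percolationProb_pos (hperc : 0 < percolationProb p) : 0 < p := by
  obtain ⟨U, hU⟩ := nonempty_of_measure_ne_zero hperc.ne'
  obtain ⟨h, hh, h0⟩ := infinite_cluster_iff.1 hU 1
  obtain ⟨_, hlt⟩ | ⟨hodd, -⟩ := (hh 0 le_rfl one_pos).imp_left And.left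
  · exact (U _).2.1.trans_lt hlt
  · simp [h0] at hodd

lemma infinite_cluster_subset_edgeGE_union_mirror (p : ℝ) (n : ℕ) :
    {U | (cluster p U).Infinite} ⊆ edgeGE p n 0 ∪ mirror ⁻¹' edgeGE p n 0 := by
  intro U hU
  obtain ⟨h, hh, h0⟩ := infinite_cluster_iff.1 hU n
  rcases le_total 0 (h n) with hn | hn
  · exact Or.inl ⟨h, hh, h0.le, hn⟩
  · refine Or.inr ⟨fun k => -h k, IsPath.of_mirror ?_, by simp [h0], by simpa using hn⟩
    rwa [mirror_mirror]

lemma edgeSpeed_nonneg_of_percolationProb_pos (hperc : 0 < percolationProb p) :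
    0 ≤ edgeSpeed p := by
  by_contra! hneg
  have hlim := tendsto_edgeGE_of_edgeSpeed_lt (p := p) (b := 0) (by simpa using hneg)
  simp only [zero_mul, Int.ceil_zero] at hlim
  have hbound (n : ℕ) : law.real {U | (cluster p U).Infinite} ≤ 2 * law.real (edgeGE p n 0) :=
    calc law.real {U | (cluster p U).Infinite}
        ≤ law.real (edgeGE p n 0) + law.real (mirror ⁻¹' edgeGE p n 0) :=
          (measureReal_mono (infinite_cluster_subset_edgeGE_union_mirror p n)).trans
            (measureReal_union_le _ _)
      _ = 2 * law.real (edgeGE p n 0) := by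
          rw [measureReal_mirror_preimage (measurableSet_edgeGE _ _ _), two_mul]
  have hzero := ge_of_tendsto' (hlim.const_mul 2) hbound
  rw [mul_zero] at hzero
  exact hperc.ne' ((measureReal_eq_zero_iff).1 (hzero.antisymm measureReal_nonneg))

/-! ### Dependence on the parameter -/

lemma ae_label_ne (p : ℝ) : ∀ᵐ U ∂law, ∀ z : Site, (U z : ℝ) ≠ p := by
  refine ae_all_iff.2 fun z => ?_
  have heval : MeasurePreserving (fun U : Labels => U z) law (volume : Measure unitInterval) :=
    measurePreserving_eval_infinitePi (fun _ : Site => (volume : Measure unitInterval)) z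
  have hnull : (volume : Measure unitInterval) {x | (x : ℝ) = p} = 0 :=
    Set.Subsingleton.measure_zero (fun x hx y hy => Subtype.ext (hx.trans hy.symm)) _
  have hne : ∀ᵐ x : unitInterval, (x : ℝ) ≠ p := by simpa [ae_iff] using hnull
  exact heval.quasiMeasurePreserving.ae hne

lemma eventually_occupiedAt_iff (hU : ∀ z : Site, (U z : ℝ) ≠ p) (n : ℕ) (m : ℤ) :
    ∀ᶠ q in 𝓝 p, OccupiedAt q U n m ↔ OccupiedAt p U n m := by
  by_cases heven : Even ((n : ℤ) + m)
  · rcases (hU (siteAt n m heven)).lt_or_gt with hlt | hgt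
    · filter_upwards [lt_mem_nhds hlt] with q hq
      exact ⟨fun _ => ⟨heven, hlt⟩, fun _ => ⟨heven, hq⟩⟩
    · filter_upwards [gt_mem_nhds hgt] with q hq
      exact ⟨fun hocc => absurd hocc.2 hq.not_gt, fun hocc => absurd hocc.2 hgt.not_gt⟩
  · exact .of_forall fun q => ⟨fun hocc => absurd hocc.even heven, fun hocc =>
      absurd hocc.even heven⟩

-- Only finitely many sites matter, and almost surely no label equals `p`.
lemma continuous_measureReal_pathEvent {C : (ℕ → ℤ) → Prop} (hC : DependsOn C (Set.Icc s e))
    {a b : ℤ} (hab : ∀ q U h, IsPath q U h s e → C h → ∀ n, s ≤ n → n < e → h n ∈ Set.Icc a b) :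
    Continuous fun q => law.real (pathEvent q s e C) := by
  refine continuous_iff_continuousAt.2 fun p => (ENNReal.tendsto_toReal (measure_ne_top _ _)).comp
    (tendsto_measure_of_ae_tendsto_indicator_of_isFiniteMeasure (𝓝 p)
      (measurableSet_pathEvent hC) (fun q => measurableSet_pathEvent hC) ?_)
  filter_upwards [ae_label_ne p] with U hU
  have hsites : ∀ᶠ q in 𝓝 p, ∀ z ∈ Finset.Ico s e ×ˢ Finset.Icc a b,
      OccupiedAt q U z.1 z.2 ↔ OccupiedAt p U z.1 z.2 :=
    (Finset.eventually_all _).2 fun z _ => eventually_occupiedAt_iff hU z.1 z.2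
  filter_upwards [hsites] with q hq
  have hiff (h : ℕ → ℤ) (hbox : ∀ n, s ≤ n → n < e → h n ∈ Set.Icc a b) :
      IsPath q U h s e ↔ IsPath p U h s e :=
    forall_congr' fun n => forall_congr' fun hs => forall_congr' fun he => by
      rw [hq (n, h n) (Finset.mem_product.2
        ⟨Finset.mem_Ico.2 ⟨hs, he⟩, Finset.mem_Icc.2 (hbox n hs he)⟩)]
  exact exists_congr fun h =>
    ⟨fun ⟨hh, hCh⟩ => ⟨(hiff h (hab q U h hh hCh)).1 hh, hCh⟩,
      fun ⟨hh, hCh⟩ => ⟨(hiff h (hab p U h hh hCh)).2 hh, hCh⟩⟩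

lemma continuous_measureReal_edgeGE (n : ℕ) (x : ℤ) :
    Continuous fun q => law.real (edgeGE q n x) := by
  refine continuous_measureReal_pathEvent (a := x - n) (b := n)
    (dependsOn_ends n.zero_le fun y z => y ≤ 0 ∧ x ≤ z) fun q U h hh hends k hk hk' => ?_
  have hstart := abs_le.1 (hh.abs_sub_le le_rfl hk hk'.le)
  have hend := abs_le.1 (hh.abs_sub_le hk hk'.le le_rfl)
  push_cast at hstart
  exact ⟨by linarith [hends.2], by linarith [hends.1]⟩

lemma upperSemicontinuous_edgeSpeed : UpperSemicontinuous edgeSpeed := by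
  rw [funext edgeSpeed_eq_iInf]
  refine upperSemicontinuous_biInf fun n _ => upperSemicontinuous_iInf fun K => ?_
  simp only [integral_truncEdge]
  exact (continuous_coe_real_ereal.comp ((continuous_const.add (continuous_finsetSum _
    fun x _ => continuous_measureReal_edgeGE n x)).div_const _)).upperSemicontinuous

lemma one_le_edgeSpeed_one : 1 ≤ edgeSpeed 1 := by
  rw [edgeSpeed_eq_iInf]
  refine le_iInf₂ fun n hn => le_iInf fun K => ?_
  have hfull : ∀ᵐ U ∂law, (n : ℝ) ≤ truncEdge 1 n K U := by
    filter_upwards [ae_label_ne 1] with U hU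
    have hdiag : U ∈ edgeGE 1 n n :=
      ⟨fun k => k, fun k _ _ => Or.inl ⟨⟨by simp, lt_of_le_of_ne (U _).2.2 (hU _)⟩, by simp⟩,
        by simp, le_rfl⟩
    exact_mod_cast le_truncEdge_of_mem_edgeGE K hdiag
  have hle := integral_mono_ae (integrable_const _) (integrable_truncEdge 1 n K) hfull
  rw [integral_const, probReal_univ, one_smul] at hle
  rw [← EReal.coe_one, EReal.coe_le_coe_iff, le_div_iff₀ (by exact_mod_cast hn), one_mul]
  exact hle

/-! ### Lower tail of the edge -/

lemma truncEdge_le_of_notMem {n K : ℕ} {r : ℝ} (hr : U ∉ edgeGE p n ⌈r⌉) (hK : -(K : ℝ) ≤ r) :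
    truncEdge p n K U ≤ r := by
  by_cases hU : ∃ x, U ∈ edgeGE p n x
  · obtain ⟨m, hm⟩ := exists_forall_mem_edgeGE_iff hU
    rw [hm, not_le, Int.lt_ceil] at hr
    rw [truncEdge_eq_max hm]
    exact max_le hr.le hK
  · push Not at hU
    rwa [truncEdge_eq_neg hU]

lemma edgeSpeed_le_of_le {n : ℕ} (hn : 1 ≤ n) {b c : ℝ} (hbc : b ≤ c) :
    edgeSpeed p ≤ ((b + law.real (edgeGE p n ⌈b * n⌉) * (c - b) +
      law.real (edgeGE p n ⌈c * n⌉) * (1 - c) : ℝ) : EReal) := by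
  have hn0 : (0 : ℝ) < n := by exact_mod_cast hn
  set B := edgeGE p n ⌈b * n⌉
  set C := edgeGE p n ⌈c * n⌉
  have hB : MeasurableSet B := measurableSet_edgeGE _ _ _
  have hC : MeasurableSet C := measurableSet_edgeGE _ _ _
  have hCB : C ⊆ B := edgeGE_subset_edgeGE le_rfl (Int.ceil_mono (by gcongr))
  obtain ⟨K, hK⟩ := exists_nat_ge (-(b * n))
  have hbound (U : Labels) : truncEdge p n K U ≤
      b * n + (B.indicator (fun _ => (c - b) * n) U + C.indicator (fun _ => (1 - c) * n) U) := by
    by_cases hUC : U ∈ C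
    · rw [Set.indicator_of_mem (hCB hUC), Set.indicator_of_mem hUC]
      linarith [truncEdge_le p n K U]
    by_cases hUB : U ∈ B
    · have hcb : b * n ≤ c * n := by gcongr
      rw [Set.indicator_of_mem hUB, Set.indicator_of_notMem hUC]
      linarith [truncEdge_le_of_notMem (K := K) hUC (by linarith)]
    · rw [Set.indicator_of_notMem hUB, Set.indicator_of_notMem hUC, add_zero, add_zero]
      exact truncEdge_le_of_notMem hUB (by linarith)
  have hintB : Integrable (B.indicator fun _ => (c - b) * n) law :=
    (integrable_const _).indicator hB
  have hintC : Integrable (C.indicator fun _ => (1 - c) * n) law :=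
    (integrable_const _).indicator hC
  have hintBC : Integrable (fun U => B.indicator (fun _ => (c - b) * n) U +
      C.indicator (fun _ => (1 - c) * n) U) law := hintB.add hintC
  refine (edgeSpeed_le_integral_truncEdge hn K).trans (EReal.coe_le_coe_iff.2 ?_)
  rw [div_le_iff₀ hn0]
  calc ∫ U, truncEdge p n K U ∂law
      ≤ ∫ U, b * n + (B.indicator (fun _ => (c - b) * n) U +
          C.indicator (fun _ => (1 - c) * n) U) ∂law :=
        integral_mono (integrable_truncEdge p n K)
          ((integrable_const _).add hintBC) hbound
    _ = (b + law.real B * (c - b) + law.real C * (1 - c)) * n := by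
        rw [integral_add (integrable_const _) hintBC, integral_add hintB hintC,
          integral_indicator_const _ hB, integral_indicator_const _ hC, integral_const,
          probReal_univ]
        simp only [smul_eq_mul]
        ring

lemma tendsto_edgeGE_compl_of_lt_edgeSpeed {b : ℝ} (hb : (b : EReal) < edgeSpeed p) :
    Tendsto (fun m : ℕ => law.real (edgeGE p m ⌈b * m⌉)ᶜ) atTop (𝓝 0) := by
  obtain ⟨α, hα⟩ : ∃ α : ℝ, edgeSpeed p = α :=
    ⟨_, (EReal.coe_toReal ((edgeSpeed_le_one p).trans_lt (EReal.coe_lt_top 1)).ne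
      (bot_le.trans_lt hb).ne').symm⟩
  have hbα : 0 < α - b := sub_pos.2 (by rwa [hα, EReal.coe_lt_coe_iff] at hb)
  refine tendsto_order.2
    ⟨fun κ hκ => .of_forall fun _ => hκ.trans_le measureReal_nonneg, fun κ hκ => ?_⟩
  obtain ⟨η, hη, hηκ⟩ : ∃ η, 0 < η ∧ 2 * η < (α - b) * κ :=
    ⟨(α - b) * κ / 3, by positivity, by linarith [mul_pos hbα hκ]⟩
  have hupper := (tendsto_edgeGE_of_edgeSpeed_lt (p := p) (b := α + η)
    (by rw [hα, EReal.coe_lt_coe_iff]; linarith)).mul_const (1 - (α + η))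
  rw [zero_mul] at hupper
  filter_upwards [hupper.eventually_lt_const hη, eventually_ge_atTop 1] with n hn hn1
  have hmean := edgeSpeed_le_of_le (p := p) hn1 (show b ≤ α + η by linarith)
  rw [hα, EReal.coe_le_coe_iff] at hmean
  rw [probReal_compl_eq_one_sub (measurableSet_edgeGE _ _ _)]
  have hle : law.real (edgeGE p n ⌈b * n⌉) * η ≤ η :=
    mul_le_of_le_one_left hη.le measureReal_le_one
  refine lt_of_mul_lt_mul_left ?_ hbα.le
  linarith

/-! ### Crossings of tubes -/

/-- Over the columns `s, …, s + L`, the height function `h` stays within distance `w` of the line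
of slope `a` through `(s, y)`. -/
def InTube (s : ℕ) (y : ℤ) (L : ℕ) (w a : ℝ) (h : ℕ → ℤ) : Prop :=
  ∀ n : ℕ, s ≤ n → n ≤ s + L → |(h n : ℝ) - (y + a * ((n : ℝ) - s))| ≤ w

/-- Some path crosses the tube of length `L` and half-width `w` around the line of slope `a`
through `(s, y)`. -/
def tube (p : ℝ) (s : ℕ) (y : ℤ) (L : ℕ) (w a : ℝ) : Set Labels :=
  pathEvent p s (s + L) (InTube s y L w a)

lemma dependsOn_inTube (s : ℕ) (y : ℤ) (L : ℕ) (w a : ℝ) :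
    DependsOn (InTube s y L w a) (Set.Icc s (s + L)) := fun f g hfg => by
  refine propext (forall_congr' fun n => forall₂_congr fun hs he => ?_)
  rw [hfg n ⟨hs, he⟩]

lemma measurableSet_tube (p : ℝ) (s : ℕ) (y : ℤ) (L : ℕ) (w a : ℝ) :
    MeasurableSet (tube p s y L w a) :=
  measurableSet_pathEvent (dependsOn_inTube s y L w a)

lemma InTube.of_abs_sub_le {y y' : ℤ} {L : ℕ} {w w' a : ℝ} (hh : InTube s y L w a h)
    (hy : |(y : ℝ) - y'| ≤ w' - w) : InTube s y' L w' a h := fun n hs he =>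
  calc |(h n : ℝ) - (y' + a * ((n : ℝ) - s))|
      = |((h n : ℝ) - (y + a * ((n : ℝ) - s))) + ((y : ℝ) - y')| := by ring_nf
    _ ≤ w + (w' - w) := (abs_add_le _ _).trans (add_le_add (hh n hs he) hy)
    _ = w' := by ring

lemma law_tube_compl_le {y : ℤ} (hy : Even ((s : ℤ) + y)) (L : ℕ) (w a : ℝ) :
    law.real (tube p s y L w a)ᶜ ≤ law.real (tube p 0 0 L w a)ᶜ := by
  rw [← measureReal_shift_preimage hy (measurableSet_tube p 0 0 L w a).compl]
  refine measureReal_mono (Set.compl_subset_compl.2 ?_)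
  rintro U ⟨h, hh, htube⟩
  refine ⟨fun n => h (n - s) + y, ?_, fun n hs he => ?_⟩
  · simpa only [zero_add, add_comm L s] using IsPath.of_shift hy hh
  · have hn := htube (n - s) (Nat.zero_le _) (by omega)
    rw [Nat.cast_sub hs] at hn
    push_cast at hn ⊢
    convert hn using 2
    ring

lemma law_tube_neg_compl_le {y : ℤ} (hy : Even ((s : ℤ) + y)) (L : ℕ) (w a : ℝ) :
    law.real (tube p s y L w (-a))ᶜ ≤ law.real (tube p 0 0 L w a)ᶜ := by
  refine (law_tube_compl_le hy L w (-a)).trans ?_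
  rw [← measureReal_mirror_preimage (measurableSet_tube p 0 0 L w a).compl]
  refine measureReal_mono (Set.compl_subset_compl.2 ?_)
  rintro U ⟨h, hh, htube⟩
  refine ⟨fun n => -h n, hh.of_mirror, fun n hs he => ?_⟩
  rw [← abs_neg]
  convert htube n hs he using 2
  push_cast
  ring

-- A tube of half-width `2 * w + 2` contains two disjoint tubes of half-width `w`.
lemma law_tube_compl_le_sq (L : ℕ) {w : ℝ} (hw : 0 ≤ w) (a : ℝ) :
    law.real (tube p 0 0 L (2 * w + 2) a)ᶜ ≤ law.real (tube p 0 0 L w a)ᶜ ^ 2 := by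
  obtain ⟨y, hyeven, hy⟩ := exists_even_add_intCast_mem_Ioc 0 (w + 2)
  rw [zero_add] at hyeven
  rw [add_sub_cancel_right, Set.mem_Ioc] at hy
  have hsub (z : ℤ) (hz : |(z : ℝ)| ≤ w + 2) :
      tube p 0 z L w a ⊆ tube p 0 0 L (2 * w + 2) a :=
    pathEvent_mono le_rfl fun h hh => hh.of_abs_sub_le (by simpa using hz.trans (by linarith))
  let strip (z : ℤ) : Set Site := {v | |(v.1.2 : ℝ) - (z + a * v.1.1)| ≤ w}
  have hstrip (z : ℤ) : MeasurableSet[labelSigma (strip z)] (tube p 0 z L w a)ᶜ :=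
    MeasurableSet.compl (measurableSet_pathEvent_labelSigma (dependsOn_inTube 0 z L w a)
      fun h hh n hs he _ => by simpa [strip, siteAt] using hh n hs he.le)
  have hdisj : Disjoint (strip y) (strip (-y)) := by
    refine Set.disjoint_left.2 fun v hv hv' => ?_
    have hupper := (abs_le.1 (Set.mem_ofPred.1 hv)).1
    have hlower := (abs_le.1 (Set.mem_ofPred.1 hv')).2
    push_cast at hlower
    linarith
  have habs : |(y : ℝ)| ≤ w + 2 := abs_le.2 ⟨by linarith, hy.2⟩
  calc law.real (tube p 0 0 L (2 * w + 2) a)ᶜ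
      ≤ law.real ((tube p 0 y L w a)ᶜ ∩ (tube p 0 (-y) L w a)ᶜ) :=
        measureReal_mono (Set.subset_inter (Set.compl_subset_compl.2 (hsub y habs))
          (Set.compl_subset_compl.2 (hsub (-y) (by simpa using habs))))
    _ = law.real (tube p 0 y L w a)ᶜ * law.real (tube p 0 (-y) L w a)ᶜ := by
        rw [measureReal_def, law_inter_of_disjoint hdisj (hstrip y) (hstrip (-y)),
          ENNReal.toReal_mul, measureReal_def, measureReal_def]
    _ ≤ law.real (tube p 0 0 L w a)ᶜ ^ 2 := by
        rw [sq]
        exact mul_le_mul (law_tube_compl_le (by simpa using hyeven) L w a)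
          (law_tube_compl_le (by simpa using hyeven) L w a) measureReal_nonneg measureReal_nonneg

lemma inTube_of_grid {k n : ℕ} {w a : ℝ} (hn : 0 < n) (ha : |a| ≤ 1) (hh : IsPath p U h 0 (k * n))
    (hgrid : ∀ j ≤ k, |(h (j * n) : ℝ) - a * (j * n : ℕ)| ≤ w) :
    InTube 0 0 (k * n) (w + 2 * n) a h := by
  intro m _ hm
  rw [zero_add] at hm
  have hle : m / n * n ≤ m := Nat.div_mul_le_self m n
  have hmk : m / n ≤ k := Nat.div_le_of_le_mul (by rwa [mul_comm])
  set i := m / n * n with hi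
  have hdist : |(h m : ℝ) - h i| ≤ (m : ℝ) - i := by
    exact_mod_cast hh.abs_sub_le i.zero_le hle hm
  have hgap : (m : ℝ) - i ≤ n := by
    have : (m : ℝ) < i + n := by exact_mod_cast Nat.lt_div_mul_add hn
    linarith
  have hslope : |a * ((m : ℝ) - i)| ≤ (m : ℝ) - i := by
    have hnonneg : (0 : ℝ) ≤ (m : ℝ) - i := sub_nonneg.2 (by exact_mod_cast hle)
    rw [abs_mul, abs_of_nonneg hnonneg]
    exact mul_le_of_le_one_left hnonneg ha
  have hi' := hgrid _ hmk
  rw [← hi] at hi'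
  push_cast only [Int.cast_zero, Nat.cast_zero]
  rw [abs_le] at *
  constructor <;> linarith

lemma lt_of_notMem_edgeGE {n : ℕ} {r : ℝ} (hU : U ∉ edgeGE p n ⌈r⌉) (hh : IsPath p U h 0 n)
    (h0 : h 0 ≤ 0) : (h n : ℝ) < r := by
  by_contra! hle
  exact hU ⟨h, hh, h0, Int.ceil_le.2 hle⟩

lemma lt_of_notMem_shift_preimage_edgeGE {m n : ℕ} {y : ℤ} (hy : Even ((m : ℤ) + y)) {r : ℝ}
    (hU : U ∉ shift m y hy ⁻¹' edgeGE p n ⌈r⌉) (hh : IsPath p U h m (m + n))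
    (hr : y + r ≤ h (m + n)) : y < h m := by
  by_contra! hle
  refine hU ?_
  have hmem := pathEvent_subset_shift_preimage_edgeGE (p := p) hy n (⌈r⌉ + y)
    (show U ∈ _ from ⟨h, hh, hle, ?_⟩)
  · rwa [add_sub_cancel_right] at hmem
  · rw [← Int.ceil_add_intCast, Int.ceil_le]
    linarith

/- The crossing is a path realizing the edge at the right end: below the upper tail at each grid
column, and not too low there since it could not catch up in time. -/
lemma tube_compl_subset {k n : ℕ} (hn : 0 < n) {a ε w : ℝ} (ha : |a| ≤ 1) (hε : 0 ≤ ε)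
    (hw : 2 * ε * (k * n : ℕ) + 2 + 2 * n ≤ w) {y : ℕ → ℤ}
    (hyeven : ∀ j, Even (((j * n : ℕ) : ℤ) + y j))
    (hy : ∀ j, (y j : ℝ) ∈ Set.Ioc (a * (j * n : ℕ) - 2 * ε * (k * n : ℕ) - 2)
      (a * (j * n : ℕ) - 2 * ε * (k * n : ℕ))) :
    (tube p 0 0 (k * n) w a)ᶜ ⊆ (edgeGE p (k * n) ⌈(a - ε) * (k * n : ℕ)⌉)ᶜ ∪
      ⋃ j ∈ Finset.Icc 1 k, (edgeGE p (j * n) ⌈(a + ε) * (j * n : ℕ)⌉ ∪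
        shift ((k - j) * n) (y (k - j)) (hyeven _) ⁻¹'
          edgeGE p (j * n) ⌈(a + ε) * (j * n : ℕ)⌉) := by
  intro U hU
  by_contra hgood
  simp only [Set.mem_union, Set.mem_iUnion, not_or, not_exists, Set.mem_compl_iff, not_not,
    Finset.mem_Icc, and_imp] at hgood
  obtain ⟨⟨h, hh, h0, hend⟩, hupper⟩ := hgood
  rw [Int.ceil_le] at hend
  have hεk : 0 ≤ ε * (k * n : ℕ) := by positivity
  suffices hgrid : ∀ j ≤ k,
      |(h (j * n) : ℝ) - a * (j * n : ℕ)| ≤ 2 * ε * (k * n : ℕ) + 2 by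
    refine hU ⟨h, by rwa [zero_add], (inTube_of_grid hn ha hh hgrid).of_abs_sub_le ?_⟩
    rw [sub_self, abs_zero]
    linarith
  intro j hj
  have hεj : ε * (j * n : ℕ) ≤ ε * (k * n : ℕ) := by gcongr
  refine abs_le.2 ⟨?_, ?_⟩
  · rcases hj.eq_or_lt with rfl | hjk
    · linarith
    have hsum : j * n + (k - j) * n = k * n := by rw [← add_mul, Nat.add_sub_of_le hj]
    have hlt : y j < h (j * n) := by
      have hcross := lt_of_notMem_shift_preimage_edgeGE (h := h) (hyeven _)
        (hupper (k - j) (by omega) (by omega)).2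
      rw [Nat.sub_sub_self hj, hsum] at hcross
      refine hcross (hh.sub (Nat.zero_le _) le_rfl) ?_
      have hyj := (hy j).2
      rw [← hsum, Nat.cast_add] at hend hyj
      rw [← hsum]
      have hεj0 : 0 ≤ ε * (j * n : ℕ) := by positivity
      linarith
    have hlt' : (y j : ℝ) < h (j * n) := by exact_mod_cast hlt
    linarith [(hy j).1]
  · rcases Nat.eq_zero_or_pos j with rfl | hj0
    · have : (h 0 : ℝ) ≤ 0 := by exact_mod_cast h0
      simp only [zero_mul, Nat.cast_zero, mul_zero, sub_zero]
      linarith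
    · linarith [lt_of_notMem_edgeGE (hupper j hj0 hj).1
        (hh.sub le_rfl (Nat.mul_le_mul_right n hj)) h0]

lemma law_tube_compl_le_sum {k n : ℕ} (hn : 0 < n) {a ε w : ℝ} (ha : |a| ≤ 1) (hε : 0 ≤ ε)
    (hw : 2 * ε * (k * n : ℕ) + 2 + 2 * n ≤ w) :
    law.real (tube p 0 0 (k * n) w a)ᶜ ≤
      law.real (edgeGE p (k * n) ⌈(a - ε) * (k * n : ℕ)⌉)ᶜ +
        ∑ j ∈ Finset.Icc 1 k, 2 * law.real (edgeGE p (j * n) ⌈(a + ε) * (j * n : ℕ)⌉) := by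
  choose y hyeven hy using fun j : ℕ => exists_even_add_intCast_mem_Ioc (j * n : ℕ)
    (a * (j * n : ℕ) - 2 * ε * (k * n : ℕ))
  refine (measureReal_mono (tube_compl_subset hn ha hε hw hyeven hy)).trans
    ((measureReal_union_le _ _).trans (add_le_add_right
      ((measureReal_biUnion_finset_le _ _).trans (Finset.sum_le_sum fun j _ => ?_)) _))
  refine (measureReal_union_le _ _).trans_eq ?_
  rw [measureReal_shift_preimage _ (measurableSet_edgeGE _ _ _), two_mul]

lemma exists_law_tube_compl_lt {α : ℝ} (hα : edgeSpeed p = α) (hα1 : |α| ≤ 1) {δ κ : ℝ}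
    (hδ : 0 < δ) (hκ : 0 < κ) (l : ℕ) :
    ∃ ℓ : ℕ, l ≤ ℓ ∧ law.real (tube p 0 0 (2 * ℓ) (δ * ℓ) α)ᶜ < κ := by
  obtain ⟨J, hJ⟩ := exists_nat_gt (8 / δ)
  have hJ0 : 0 < J := by exact_mod_cast (show (0 : ℝ) < 8 / δ by positivity).trans hJ
  rw [div_lt_iff₀ hδ] at hJ
  have hcols {j : ℕ} (hj : 0 < j) : Tendsto (fun n : ℕ => j * n) atTop atTop :=
    tendsto_id.const_mul_atTop' hj
  have hlower : Tendsto (fun n : ℕ =>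
      law.real (edgeGE p (2 * J * n) ⌈(α - δ / 8) * (2 * J * n : ℕ)⌉)ᶜ) atTop (𝓝 0) :=
    (tendsto_edgeGE_compl_of_lt_edgeSpeed (by rw [hα, EReal.coe_lt_coe_iff]; linarith)).comp
      (hcols (by omega))
  have hupper : Tendsto (fun n : ℕ => ∑ j ∈ Finset.Icc 1 (2 * J),
      2 * law.real (edgeGE p (j * n) ⌈(α + δ / 8) * (j * n : ℕ)⌉)) atTop
        (𝓝 (∑ j ∈ Finset.Icc 1 (2 * J), 2 * 0)) :=
    tendsto_finsetSum _ fun j hj =>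
      ((tendsto_edgeGE_of_edgeSpeed_lt (by rw [hα, EReal.coe_lt_coe_iff]; linarith)).comp
      (hcols (Finset.mem_Icc.1 hj).1)).const_mul 2
  have hboth := hlower.add hupper
  simp only [mul_zero, Finset.sum_const_zero, add_zero] at hboth
  obtain ⟨n, hnκ, hnl, hn0⟩ := ((hboth.eventually_lt_const hκ).and
    ((eventually_ge_atTop l).and (eventually_ge_atTop 1))).exists
  refine ⟨J * n, hnl.trans (Nat.le_mul_of_pos_left n hJ0), ?_⟩
  rw [← mul_assoc]
  refine (law_tube_compl_le_sum hn0 hα1 (by positivity) ?_).trans_lt hnκ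
  have hn1 : (1 : ℝ) ≤ n := by exact_mod_cast hn0
  push_cast
  nlinarith

/-! ### Lanes: concatenations of tubes -/

/-- Some path over the columns `0, …, N * ℓ` stays within distance `4 * ℓ` of the line of slope `a'`
through `(0, y)`, and over the first `ℓ` columns within distance `w` of the line of slope `a`. -/
def lane (p : ℝ) (y : ℤ) (ℓ N : ℕ) (w a a' : ℝ) : Set Labels :=
  pathEvent p 0 (N * ℓ) fun h => InTube 0 y (N * ℓ) (4 * ℓ) a' h ∧ InTube 0 y ℓ w a h

/-- The sites within vertical distance `r` of the line of slope `a` through `(0, y)`. -/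
def band (y : ℤ) (r a : ℝ) : Set (ℕ × ℤ) :=
  {z | |(z.2 : ℝ) - (y + a * z.1)| ≤ r}

/-- The layout of the tubes of length `2 * ℓ` that form a lane of slope `D / ℓ`. The `i`-th tube of
slope `a` starts at `(i * ℓ, y + i * D)`; the tube of slope `-a` that starts at
`((i + 1) * ℓ, y + i * D + Y)` joins it to the next one. The bounds make the joining tube start
above the `i`-th tube and be below the next one `ℓ` columns later. -/
structure LaneShape (ℓ : ℕ) (w a : ℝ) (D Y : ℤ) : Prop where
  length_pos : 0 < ℓ
  width_nonneg : 0 ≤ w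
  slope_le_one : a ≤ 1
  width_le : 6 * w + 4 ≤ 2 * a * ℓ
  drift_mem : (D : ℝ) ∈ Set.Icc (a * ℓ - 2 * w - 2) (a * ℓ - 2 * w)
  offset_mem : (Y : ℝ) ∈ Set.Icc (a * ℓ + 2 * w) (a * ℓ + 2 * w + 2)

namespace LaneShape

variable {ℓ N i : ℕ} {w a : ℝ} {y D Y : ℤ}

lemma cast_length_pos (hL : LaneShape ℓ w a D Y) : (0 : ℝ) < ℓ := Nat.cast_pos.2 hL.length_pos

lemma slope_mul_length_le (hL : LaneShape ℓ w a D Y) : a * ℓ ≤ ℓ :=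
  mul_le_of_le_one_left ℓ.cast_nonneg hL.slope_le_one

lemma drift_div_le (hL : LaneShape ℓ w a D Y) : (D : ℝ) / ℓ ≤ a := by
  rw [div_le_iff₀ hL.cast_length_pos]
  linarith [hL.drift_mem.2, hL.width_nonneg]

lemma le_drift_div (hL : LaneShape ℓ w a D Y) : a - (2 * w + 2) / ℓ ≤ (D : ℝ) / ℓ := by
  rw [sub_le_iff_le_add, ← add_div, le_div_iff₀ hL.cast_length_pos]
  linarith [hL.drift_mem.1]

lemma neg_le_drift_div (hL : LaneShape ℓ w a D Y) : -a ≤ (D : ℝ) / ℓ := by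
  rw [le_div_iff₀ hL.cast_length_pos]
  linarith [hL.drift_mem.1, hL.width_le, hL.width_nonneg]

lemma drift_div_mul (hL : LaneShape ℓ w a D Y) (x : ℝ) : (D : ℝ) / ℓ * (x * ℓ) = x * D := by
  field_simp [hL.cast_length_pos.ne']

lemma graphIn_band (hL : LaneShape ℓ w a D Y)
    (hf : InTube (i * ℓ) (y + i * D) (2 * ℓ) w a f) :
    GraphIn f (i * ℓ) (i * ℓ + 2 * ℓ) (band y (4 * ℓ) (D / ℓ)) := by
  intro n hn hn'
  have hclose := hf n hn hn'
  have hnr : (i : ℝ) * ℓ ≤ n := by exact_mod_cast hn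
  have hnr' : (n : ℝ) ≤ i * ℓ + 2 * ℓ := by exact_mod_cast hn'
  have hdrift := hL.drift_div_mul i
  have hdrift' := hL.drift_div_mul 1
  have hdev : 0 ≤ (a - D / ℓ) * (n - i * ℓ) :=
    mul_nonneg (sub_nonneg.2 hL.drift_div_le) (sub_nonneg.2 hnr)
  have hdev' : (a - D / ℓ) * (n - i * ℓ) ≤ (a - D / ℓ) * (2 * ℓ) :=
    mul_le_mul_of_nonneg_left (by linarith) (by linarith [hL.drift_div_le])
  push_cast at hclose
  rw [abs_le] at hclose
  refine Set.mem_ofPred.2 (abs_le.2 ⟨?_, ?_⟩) <;> dsimp only <;>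
    linarith [hL.width_nonneg, hL.width_le, hL.drift_mem.1, hL.slope_mul_length_le]

lemma graphIn_band_connector (hL : LaneShape ℓ w a D Y)
    (hg : InTube ((i + 1) * ℓ) (y + i * D + Y) (2 * ℓ) w (-a) g) :
    GraphIn g ((i + 1) * ℓ) ((i + 1) * ℓ + ℓ) (band y (4 * ℓ) (D / ℓ)) := by
  intro n hn hn'
  have hclose := hg n hn (by omega)
  have hnr : ((i : ℝ) + 1) * ℓ ≤ n := by exact_mod_cast hn
  have hnr' : (n : ℝ) ≤ (i + 1) * ℓ + ℓ := by exact_mod_cast hn'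
  have hdrift := hL.drift_div_mul (i + 1)
  have hdrift' := hL.drift_div_mul 1
  have hdev : 0 ≤ (D / ℓ - -a) * (n - (i + 1) * ℓ) :=
    mul_nonneg (sub_nonneg.2 hL.neg_le_drift_div) (sub_nonneg.2 hnr)
  have hdev' : (D / ℓ - -a) * (n - (i + 1) * ℓ) ≤ (D / ℓ - -a) * ℓ :=
    mul_le_mul_of_nonneg_left (by linarith) (by linarith [hL.neg_le_drift_div])
  push_cast at hclose
  rw [abs_le] at hclose
  refine Set.mem_ofPred.2 (abs_le.2 ⟨?_, ?_⟩) <;> dsimp only <;>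
    linarith [hL.width_nonneg, hL.width_le, hL.drift_mem.1, hL.drift_mem.2, hL.offset_mem.1,
      hL.offset_mem.2, hL.slope_mul_length_le]

lemma reach_next {f' : ℕ → ℤ} (hL : LaneShape ℓ w a D Y)
    (hf : IsPath p U f (i * ℓ) (i * ℓ + 2 * ℓ))
    (hg : IsPath p U g ((i + 1) * ℓ) ((i + 1) * ℓ + 2 * ℓ))
    (hf' : IsPath p U f' ((i + 1) * ℓ) ((i + 1) * ℓ + 2 * ℓ))
    (hfT : InTube (i * ℓ) (y + i * D) (2 * ℓ) w a f)
    (hgT : InTube ((i + 1) * ℓ) (y + i * D + Y) (2 * ℓ) w (-a) g)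
    (hfT' : InTube ((i + 1) * ℓ) (y + (i + 1 : ℕ) * D) (2 * ℓ) w a f') :
    Reach p U (band y (4 * ℓ) (D / ℓ)) ((i + 1) * ℓ) (f ((i + 1) * ℓ)) ((i + 1) * ℓ + ℓ)
      (f' ((i + 1) * ℓ + ℓ)) := by
  have hcol : (i + 1) * ℓ = i * ℓ + ℓ := by ring
  have hband' := hL.graphIn_band hfT'
  refine reach_of_connector (hf.sub (by omega) (by omega)) (hg.sub le_rfl (by omega))
    (hf'.sub le_rfl (by omega)) (by omega)
    (fun n hn hn' => hL.graphIn_band hfT n (by omega) (by omega))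
    (hL.graphIn_band_connector hgT) (fun n hn hn' => hband' n hn (by omega)) ?_ ?_
    fun n hn hn' => ?_
  · have hfs := (abs_le.1 (hfT ((i + 1) * ℓ) (by omega) (by omega))).2
    have hgs := (abs_le.1 (hgT ((i + 1) * ℓ) le_rfl (by omega))).1
    push_cast at hfs hgs
    have : (f ((i + 1) * ℓ) : ℝ) ≤ g ((i + 1) * ℓ) := by linarith [hL.offset_mem.1]
    exact_mod_cast this
  · have hge := (abs_le.1 (hgT ((i + 1) * ℓ + ℓ) (by omega) (by omega))).2
    have hfe := (abs_le.1 (hfT' ((i + 1) * ℓ + ℓ) (by omega) (by omega))).1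
    push_cast at hge hfe
    have : (g ((i + 1) * ℓ + ℓ) : ℝ) ≤ f' ((i + 1) * ℓ + ℓ) := by
      linarith [hL.offset_mem.2, hL.drift_mem.1, hL.width_le]
    exact_mod_cast this
  · have hfn := (abs_le.1 (hfT n (by omega) (by omega))).1
    have hfn' := (abs_le.1 (hfT' n hn (by omega))).2
    push_cast at hfn hfn'
    have : (f' n : ℝ) ≤ f n := by linarith [hL.drift_mem.2]
    exact_mod_cast this

lemma mem_lane (hL : LaneShape ℓ w a D Y) (hN : 1 ≤ N)
    (htube : ∀ i < N, U ∈ tube p (i * ℓ) (y + i * D) (2 * ℓ) w a)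
    (hconn : ∀ i < N, U ∈ tube p ((i + 1) * ℓ) (y + i * D + Y) (2 * ℓ) w (-a)) :
    U ∈ lane p y ℓ N w a (D / ℓ) := by
  choose! f hf hfT using htube
  choose! g hg hgT using hconn
  have hchain (i : ℕ) (hi : i < N) :
      Reach p U (band y (4 * ℓ) (D / ℓ)) ℓ (f 0 ℓ) (i * ℓ + ℓ) (f i (i * ℓ + ℓ)) := by
    induction i with
    | zero =>
      simpa using (hf 0 hi).reach (hL.graphIn_band (hfT 0 hi)) (m := ℓ) (n := ℓ)
        (by omega) le_rfl (by omega)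
    | succ i ih =>
      have hi' : i < N := by omega
      have hstart := ih hi'
      rw [← Nat.succ_mul] at hstart
      exact hstart.trans (hL.reach_next (hf i hi') (hg i hi') (hf (i + 1) hi) (hfT i hi')
        (hgT i hi') (hfT (i + 1) hi))
  obtain ⟨hle, P, hP, hPband, hP0, -⟩ := hchain (N - 1) (by omega)
  rw [← Nat.succ_mul, Nat.succ_eq_add_one, Nat.sub_add_cancel hN] at hle hP hPband
  have hband₀ := hL.graphIn_band (hfT 0 (by omega))
  refine ⟨_, ((hf 0 (by omega)).sub (by omega) (by omega)).glue hP hP0.symm,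
    fun n _ hn => ?_, fun n _ hn => ?_⟩
  · rw [Nat.cast_zero, sub_zero]
    dsimp only
    split_ifs with hnℓ
    · exact hband₀ n (by omega) (by omega)
    · exact hPband n (by omega) (by omega)
  · dsimp only
    rw [if_pos (by omega)]
    simpa using hfT 0 (by omega) n (by omega) (by omega)

lemma law_lane_compl_le (hL : LaneShape ℓ w a D Y) (hN : 1 ≤ N) (hy : Even y)
    (hD : Even ((ℓ : ℤ) + D)) (hY : Even ((ℓ : ℤ) + Y)) :
    law.real (lane p y ℓ N w a (D / ℓ))ᶜ ≤ 2 * N * law.real (tube p 0 0 (2 * ℓ) w a)ᶜ := by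
  have htube (i : ℕ) : Even (((i * ℓ : ℕ) : ℤ) + (y + i * D)) := by
    rw [show ((i * ℓ : ℕ) : ℤ) + (y + i * D) = i * (ℓ + D) + y by push_cast; ring]
    exact (hD.mul_left _).add hy
  have hconn (i : ℕ) : Even ((((i + 1) * ℓ : ℕ) : ℤ) + (y + i * D + Y)) := by
    rw [show (((i + 1) * ℓ : ℕ) : ℤ) + (y + i * D + Y) =
      ((i * ℓ : ℕ) : ℤ) + (y + i * D) + (ℓ + Y) by push_cast; ring]
    exact (htube i).add hY
  have hsub : (lane p y ℓ N w a (D / ℓ))ᶜ ⊆ ⋃ i ∈ Finset.range N,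
      ((tube p (i * ℓ) (y + i * D) (2 * ℓ) w a)ᶜ ∪
        (tube p ((i + 1) * ℓ) (y + i * D + Y) (2 * ℓ) w (-a))ᶜ) := by
    intro U hU
    by_contra hgood
    simp only [Set.mem_iUnion, Set.mem_union, Set.mem_compl_iff, Finset.mem_range, not_exists,
      not_or, not_not] at hgood
    exact hU (hL.mem_lane hN (fun i hi => (hgood i hi).1) fun i hi => (hgood i hi).2)
  calc law.real (lane p y ℓ N w a (D / ℓ))ᶜ
      ≤ ∑ i ∈ Finset.range N, law.real ((tube p (i * ℓ) (y + i * D) (2 * ℓ) w a)ᶜ ∪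
          (tube p ((i + 1) * ℓ) (y + i * D + Y) (2 * ℓ) w (-a))ᶜ) :=
        (measureReal_mono hsub (measure_ne_top _ _)).trans (measureReal_biUnion_finset_le _ _)
    _ ≤ ∑ _i ∈ Finset.range N, 2 * law.real (tube p 0 0 (2 * ℓ) w a)ᶜ := by
        refine Finset.sum_le_sum fun i _ => (measureReal_union_le _ _).trans ?_
        exact (add_le_add (law_tube_compl_le (htube i) _ w a)
          (law_tube_neg_compl_le (hconn i) _ w a)).trans_eq (two_mul _).symm
    _ = 2 * N * law.real (tube p 0 0 (2 * ℓ) w a)ᶜ := by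
        rw [Finset.sum_const, Finset.card_range, nsmul_eq_mul]
        ring

end LaneShape

lemma exists_lane_slope {ℓ : ℕ} (hℓ : 0 < ℓ) {w a : ℝ} (hw : 0 ≤ w) (ha : a ≤ 1)
    (hwa : 6 * w + 4 ≤ 2 * a * ℓ) :
    ∃ a' ∈ Set.Icc (a - (2 * w + 2) / ℓ) a, ∀ (p : ℝ) (N : ℕ) (y : ℤ), 1 ≤ N → Even y →
      law.real (lane p y ℓ N w a a')ᶜ ≤ 2 * N * law.real (tube p 0 0 (2 * ℓ) w a)ᶜ := by
  obtain ⟨D, hD, hDmem⟩ := exists_even_add_intCast_mem_Ioc ℓ (a * ℓ - 2 * w)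
  obtain ⟨Y, hY, hYmem⟩ := exists_even_add_intCast_mem_Ioc ℓ (a * ℓ + 2 * w + 2)
  rw [add_sub_cancel_right] at hYmem
  have hL : LaneShape ℓ w a D Y :=
    ⟨hℓ, hw, ha, hwa, Set.Ioc_subset_Icc_self hDmem, Set.Ioc_subset_Icc_self hYmem⟩
  exact ⟨D / ℓ, ⟨hL.le_drift_div, hL.drift_div_le⟩,
    fun p N y hN hy => hL.law_lane_compl_le hN hy hD hY⟩

lemma lane_subset_tube {ℓ N : ℕ} {w a a' : ℝ} :
    lane p 0 ℓ N w a a' ⊆ tube p 0 0 (N * ℓ) (4 * ℓ) a' := by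
  simpa only [lane, tube, zero_add] using pathEvent_mono le_rfl fun h hh => hh.1

/-! ### Multiscale analysis -/

/-- The factor between the lengths at scales `k` and `k + 1`. -/
def scaleFactor (M k : ℕ) : ℕ := M * 2 ^ k

/-- Half the length of the tubes at scale `k`. -/
def scaleLength (M l : ℕ) : ℕ → ℕ
  | 0 => l
  | k + 1 => scaleFactor M k * scaleLength M l k

/-- The half-width of the tubes at scale `k`. -/
def scaleWidth (M l k : ℕ) : ℝ := 20 * scaleLength M l k / scaleFactor M k

/-- The bound for the probability that a tube at scale `k` is not crossed. -/
def scaleBound (M k : ℕ) : ℝ := (1 / 4) ^ k / (256 * (scaleFactor M k : ℝ) ^ 2)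

/-- The requirements on the initial factor `M` and the initial half-length `l` under which slopes
stay above `b` at all scales. -/
structure ScaleParams (b : ℝ) (M l : ℕ) : Prop where
  slope_pos : 0 < b
  two_le : 2 ≤ M
  le_slope_mul : 62 ≤ b * M
  le_length : M ≤ l

/-- At scale `k` the tube of slope `a` is crossed with high probability, and `a` exceeds `b` by at
least the total loss of slope `∑ j ≥ k, 42 / scaleFactor M j` over the subsequent scales. -/
structure GoodScale (p b : ℝ) (M l k : ℕ) (a : ℝ) : Prop where
  le_slope : b + 84 / scaleFactor M k ≤ a
  slope_le_one : a ≤ 1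
  law_compl_le_scaleBound :
    law.real (tube p 0 0 (2 * scaleLength M l k) (scaleWidth M l k) a)ᶜ ≤ scaleBound M k

section Scales

variable {a b : ℝ} {M l k : ℕ}

lemma cast_scaleFactor_succ : (scaleFactor M (k + 1) : ℝ) = 2 * scaleFactor M k := by
  simp only [scaleFactor, pow_succ]
  push_cast
  ring

lemma le_scaleFactor : M ≤ scaleFactor M k := Nat.le_mul_of_pos_right M (by positivity)

lemma scaleWidth_nonneg : 0 ≤ scaleWidth M l k := by unfold scaleWidth; positivity

lemma scaleBound_nonneg : 0 ≤ scaleBound M k := by unfold scaleBound; positivity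

lemma GoodScale.slope_le (h : GoodScale p b M l k a) : b ≤ a :=
  (le_add_of_nonneg_right (by positivity)).trans h.le_slope

namespace ScaleParams

lemma scaleFactor_pos (hP : ScaleParams b M l) : 0 < scaleFactor M k :=
  lt_of_lt_of_le (by linarith [hP.two_le]) le_scaleFactor

lemma one_le_cast_scaleFactor (hP : ScaleParams b M l) : (1 : ℝ) ≤ scaleFactor M k := by
  exact_mod_cast hP.scaleFactor_pos

lemma scaleFactor_le_scaleLength (hP : ScaleParams b M l) :
    scaleFactor M k ≤ scaleLength M l k := by
  induction k with
  | zero => simpa [scaleFactor, scaleLength] using hP.le_length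
  | succ k ih =>
    calc scaleFactor M (k + 1) = scaleFactor M k * 2 := by simp only [scaleFactor, pow_succ]; ring
      _ ≤ scaleFactor M k * scaleLength M l k :=
        Nat.mul_le_mul_left _ (hP.two_le.trans (le_scaleFactor.trans ih))

lemma lt_scaleLength (hP : ScaleParams b M l) : k < scaleLength M l k :=
  calc k < 2 ^ k := Nat.lt_two_pow_self
    _ ≤ scaleFactor M k := Nat.le_mul_of_pos_left _ (by linarith [hP.two_le])
    _ ≤ scaleLength M l k := hP.scaleFactor_le_scaleLength

lemma scaleLength_le_succ (hP : ScaleParams b M l) : scaleLength M l k ≤ scaleLength M l (k + 1) :=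
  Nat.le_mul_of_pos_left _ hP.scaleFactor_pos

lemma scaleWidth_mul (hP : ScaleParams b M l) :
    scaleWidth M l k * scaleFactor M k = 20 * scaleLength M l k :=
  div_mul_cancel₀ _ (Nat.cast_ne_zero.2 hP.scaleFactor_pos.ne')

lemma scaleWidth_succ (hP : ScaleParams b M l) :
    scaleWidth M l (k + 1) = 10 * scaleLength M l k := by
  have hpos := hP.one_le_cast_scaleFactor (k := k)
  rw [scaleWidth, cast_scaleFactor_succ, scaleLength]
  push_cast
  field_simp
  ring

lemma le_slope_mul_scaleFactor (hP : ScaleParams b M l) (hba : b ≤ a) :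
    62 ≤ a * scaleFactor M k :=
  hP.le_slope_mul.trans (mul_le_mul hba (Nat.cast_le.2 le_scaleFactor) M.cast_nonneg
    (hP.slope_pos.le.trans hba))

lemma scaleWidth_le (hP : ScaleParams b M l) (hba : b ≤ a) :
    6 * scaleWidth M l k + 4 ≤ 2 * a * scaleLength M l k := by
  have hfactor := hP.one_le_cast_scaleFactor (k := k)
  have hlength : (scaleFactor M k : ℝ) ≤ scaleLength M l k :=
    Nat.cast_le.2 hP.scaleFactor_le_scaleLength
  refine le_of_mul_le_mul_right ?_ (zero_lt_one.trans_le hfactor)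
  nlinarith [hP.scaleWidth_mul (k := k), hP.le_slope_mul_scaleFactor (k := k) hba]

lemma slope_loss_le (hP : ScaleParams b M l) :
    (2 * scaleWidth M l k + 2) / scaleLength M l k ≤ 42 / scaleFactor M k := by
  have hfactor := hP.one_le_cast_scaleFactor (k := k)
  have hlength : (scaleFactor M k : ℝ) ≤ scaleLength M l k :=
    Nat.cast_le.2 hP.scaleFactor_le_scaleLength
  rw [div_le_div_iff₀ (by linarith) (by linarith)]
  linarith [hP.scaleWidth_mul (k := k)]

lemma scaleFactor_mul_scaleBound_le (hP : ScaleParams b M l) :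
    scaleFactor M k * scaleBound M k ≤ (1 / 4) ^ k / 256 := by
  have hfactor := hP.one_le_cast_scaleFactor (k := k)
  calc scaleFactor M k * scaleBound M k = (1 / 4) ^ k / 256 / scaleFactor M k := by
        rw [scaleBound]
        field_simp
    _ ≤ (1 / 4) ^ k / 256 := div_le_self (by positivity) hfactor

lemma scaleBound_le (hP : ScaleParams b M l) : scaleBound M k ≤ (1 / 4) ^ k / 256 :=
  (le_mul_of_one_le_left scaleBound_nonneg hP.one_le_cast_scaleFactor).trans
    hP.scaleFactor_mul_scaleBound_le

lemma sq_scaleBound_le (hP : ScaleParams b M l) :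
    (4 * scaleFactor M k * scaleBound M k) ^ 2 ≤ scaleBound M (k + 1) := by
  have hfactor := hP.one_le_cast_scaleFactor (k := k)
  calc (4 * scaleFactor M k * scaleBound M k) ^ 2
      = (1 / 4) ^ k * scaleBound M (k + 1) := by
        rw [scaleBound, scaleBound, cast_scaleFactor_succ, pow_succ (1 / 4 : ℝ) k]
        field_simp
        norm_num
    _ ≤ scaleBound M (k + 1) :=
        mul_le_of_le_one_left scaleBound_nonneg (pow_le_one₀ (by norm_num) (by norm_num))

end ScaleParams

lemma law_tube_scale_succ_compl_le_sq (hP : ScaleParams b M l) :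
    law.real (tube p 0 0 (2 * scaleLength M l (k + 1)) (scaleWidth M l (k + 1)) a)ᶜ ≤
      law.real (tube p 0 0 (2 * scaleLength M l (k + 1)) (4 * scaleLength M l k) a)ᶜ ^ 2 := by
  have hlength : (1 : ℝ) ≤ scaleLength M l k := by
    exact_mod_cast k.zero_le.trans_lt hP.lt_scaleLength
  refine (measureReal_mono (Set.compl_subset_compl.2 ?_)).trans
    (law_tube_compl_le_sq _ (by positivity) a)
  refine pathEvent_mono le_rfl fun h hh => hh.of_abs_sub_le ?_
  rw [sub_self, abs_zero, hP.scaleWidth_succ]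
  linarith

lemma GoodScale.exists_succ (hP : ScaleParams b M l) (h : GoodScale p b M l k a) :
    ∃ a', GoodScale p b M l (k + 1) a' ∧ ∀ y : ℤ, Even y →
      law.real (lane p y (scaleLength M l k) (2 * scaleFactor M k) (scaleWidth M l k) a a')ᶜ ≤
        4 * scaleFactor M k * scaleBound M k := by
  have hfactor : 0 < scaleFactor M k := hP.scaleFactor_pos
  obtain ⟨a', ⟨hle, hge⟩, hlane⟩ := exists_lane_slope (hfactor.trans_le
    hP.scaleFactor_le_scaleLength) scaleWidth_nonneg h.slope_le_one (hP.scaleWidth_le h.slope_le)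
  replace hlane (y : ℤ) (hy : Even y) : law.real (lane p y (scaleLength M l k)
      (2 * scaleFactor M k) (scaleWidth M l k) a a')ᶜ ≤ 4 * scaleFactor M k * scaleBound M k :=
    calc _ ≤ 2 * (2 * scaleFactor M k : ℕ) * law.real
          (tube p 0 0 (2 * scaleLength M l k) (scaleWidth M l k) a)ᶜ := hlane p _ y (by omega) hy
      _ ≤ 2 * (2 * scaleFactor M k : ℕ) * scaleBound M k := by
        gcongr
        exact h.law_compl_le_scaleBound
      _ = 4 * scaleFactor M k * scaleBound M k := by push_cast; ring
  refine ⟨a', ⟨?_, hge.trans h.slope_le_one, ?_⟩, hlane⟩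
  · have hhalf : (84 : ℝ) / scaleFactor M (k + 1) =
        84 / scaleFactor M k - 42 / scaleFactor M k := by
      rw [cast_scaleFactor_succ]
      field_simp
      norm_num
    linarith [h.le_slope, hP.slope_loss_le (k := k)]
  · have htube : lane p 0 (scaleLength M l k) (2 * scaleFactor M k) (scaleWidth M l k) a a' ⊆
        tube p 0 0 (2 * scaleLength M l (k + 1)) (4 * scaleLength M l k) a' := by
      rw [scaleLength, ← mul_assoc]
      exact lane_subset_tube
    calc _ ≤ law.real (tube p 0 0 (2 * scaleLength M l (k + 1)) (4 * scaleLength M l k) a')ᶜ ^ 2 :=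
          law_tube_scale_succ_compl_le_sq hP
      _ ≤ (4 * scaleFactor M k * scaleBound M k) ^ 2 := by
          gcongr
          exact (measureReal_mono (Set.compl_subset_compl.2 htube)).trans (hlane 0 Even.zero)
      _ ≤ scaleBound M (k + 1) := hP.sq_scaleBound_le

lemma GoodScale.exists_slopes (hP : ScaleParams b M l) (h : GoodScale p b M l 0 a) :
    ∃ c : ℕ → ℝ, ∀ k, GoodScale p b M l k (c k) ∧ ∀ y : ℤ, Even y →
      law.real (lane p y (scaleLength M l k) (2 * scaleFactor M k) (scaleWidth M l k) (c k)
        (c (k + 1)))ᶜ ≤ 4 * scaleFactor M k * scaleBound M k := by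
  choose! next hnext hlane using fun k a =>
    GoodScale.exists_succ (p := p) (b := b) (M := M) (l := l) (k := k) (a := a) hP
  let c : ℕ → ℝ := fun k => Nat.rec a next k
  have hgood (k : ℕ) : GoodScale p b M l k (c k) := by
    induction k with
    | zero => exact h
    | succ k ih => exact hnext k (c k) ih
  exact ⟨c, fun k => ⟨hgood k, hlane k (c k) (hgood k)⟩⟩

end Scales

/-! ### Consequences of a single good tube -/

lemma law_iInter_pathEvent_eq_zero (hp : percolationProb p = 0) {y : ℤ}
    (hy : Even ((s : ℤ) + y)) :
    law {U | ∀ n, U ∈ pathEvent p s (n + s) fun h => h s = y} = 0 := by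
  refine measure_mono_null (fun U hU => ?_) ((measurePreserving_relabel
    (shiftSite_injective s y hy)).quasiMeasurePreserving.preimage_null hp)
  refine infinite_cluster_iff.2 fun n => ?_
  obtain ⟨h, hh, hs⟩ := hU n
  refine ⟨fun k => h (k + s) - y, IsPath.to_shift hy (by rwa [zero_add]), ?_⟩
  change h (0 + s) - y = 0
  rw [zero_add, hs, sub_self]

lemma law_iInter_pathEvent_zero_eq_zero (hp : percolationProb p = 0) (y : ℤ) :
    law {U | ∀ n, U ∈ pathEvent p 0 n fun h => h 0 = y} = 0 := by
  rcases Int.even_or_odd y with hy | hy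
  · exact law_iInter_pathEvent_eq_zero (s := 0) hp (by simpa using hy)
  · have heven : Even (((1 : ℕ) : ℤ) + y) := by
      rw [Nat.cast_one, add_comm]
      exact hy.add_one
    refine measure_mono_null (fun U hU => ?_) (law_iInter_pathEvent_eq_zero hp heven)
    refine Set.mem_ofPred.2 fun n => ?_
    obtain ⟨h, hh, h0⟩ := hU (n + 1)
    refine ⟨h, hh.sub zero_le_one le_rfl, ?_⟩
    rcases hh 0 le_rfl (by omega) with hocc | hskip
    · have heven := hocc.1.even
      rw [h0, Nat.cast_zero, zero_add] at heven
      exact absurd hy (Int.not_odd_iff_even.2 heven)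
    · rw [← h0]
      exact hskip.2

section Scales

variable {a b : ℝ} {M l k : ℕ}

lemma GoodScale.half_le_law_edgeGE (hP : ScaleParams b M l) (h : GoodScale p b M l k a) :
    1 / 2 ≤ law.real
      (edgeGE p (2 * scaleLength M l k) ⌈b * (2 * scaleLength M l k : ℕ)⌉) := by
  set w := scaleWidth M l k
  obtain ⟨y, hyeven, hyw⟩ := exists_even_add_intCast_mem_Ioc 0 (-w)
  have hgain : 2 * w + 2 ≤ (a - b) * (2 * scaleLength M l k) := by
    have hlength : (0 : ℝ) < scaleLength M l k :=
      Nat.cast_pos.2 (k.zero_le.trans_lt hP.lt_scaleLength)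
    have hslope : (42 : ℝ) / scaleFactor M k ≤ (a - b) * 2 := by
      have : (0 : ℝ) ≤ 42 / scaleFactor M k := by positivity
      have hdouble : (84 : ℝ) / scaleFactor M k = 42 / scaleFactor M k * 2 := by ring
      linarith [h.le_slope]
    rw [← mul_assoc, ← div_le_iff₀ hlength]
    exact hP.slope_loss_le.trans hslope
  have hsub : tube p 0 y (2 * scaleLength M l k) w a ⊆
      edgeGE p (2 * scaleLength M l k) ⌈b * (2 * scaleLength M l k : ℕ)⌉ := by
    rintro U ⟨h, hh, htube⟩
    rw [zero_add] at hh
    have hstart := (abs_le.1 (htube 0 le_rfl (Nat.zero_le _))).2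
    have hend := (abs_le.1 (htube (2 * scaleLength M l k) (Nat.zero_le _) (by omega))).1
    push_cast at hstart hend
    refine ⟨h, hh, ?_, Int.ceil_le.2 ?_⟩
    · have : (h 0 : ℝ) ≤ 0 := by linarith [hyw.2]
      exact_mod_cast this
    · push_cast
      linarith [hyw.1]
  have hfail : law.real (tube p 0 y (2 * scaleLength M l k) w a)ᶜ ≤ 1 / 2 :=
    calc _ ≤ scaleBound M k :=
          (law_tube_compl_le (by simpa using hyeven) _ _ _).trans h.law_compl_le_scaleBound
      _ ≤ (1 / 4) ^ k / 256 := hP.scaleBound_le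
      _ ≤ 1 / 2 := by
        have hpow : (1 / 4 : ℝ) ^ k ≤ 1 := pow_le_one₀ (by norm_num) (by norm_num)
        linarith
  rw [probReal_compl_eq_one_sub (measurableSet_tube _ _ _ _ _ _)] at hfail
  linarith [measureReal_mono (μ := law) hsub]

lemma GoodScale.le_edgeSpeed (hP : ScaleParams b M l) (h : GoodScale p b M l 0 a) :
    (b : EReal) ≤ edgeSpeed p := by
  obtain ⟨c, hc⟩ := h.exists_slopes hP
  by_contra! hlt
  have hlength : Tendsto (fun k => 2 * scaleLength M l k) atTop atTop :=
    tendsto_atTop_mono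
      (fun k => hP.lt_scaleLength.le.trans (Nat.le_mul_of_pos_left _ zero_lt_two)) tendsto_id
  obtain ⟨k, hk⟩ := (((tendsto_edgeGE_of_edgeSpeed_lt hlt).comp hlength).eventually_lt_const
    one_half_pos).exists
  exact hk.not_ge ((hc k).1.half_le_law_edgeGE hP)

/-- The height at which the lane at scale `k` starts. The tube of half-width
`10 * scaleLength M l k` around the lane at scale `k + 1` thus lies below the one of half-width
`4 * scaleLength M l k` around the lane at scale `k`. -/
def startHeight (M l : ℕ) : ℕ → ℤ
  | 0 => 0
  | k + 1 => startHeight M l k - 14 * scaleLength M l k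

/-- The lane at scale `k` exists, and so does a descending crossing that joins it to the lane at
scale `k + 1`. -/
def chainLink (p : ℝ) (M l : ℕ) (c : ℕ → ℝ) (k : ℕ) : Set Labels :=
  lane p (startHeight M l k) (scaleLength M l k) (2 * scaleFactor M k) (scaleWidth M l k) (c k)
      (c (k + 1)) ∩
    tube p 0 (startHeight M l k + 16 * scaleLength M l k) (2 * scaleLength M l (k + 1))
      (scaleWidth M l (k + 1)) (-c (k + 1))

lemma even_startHeight : Even (startHeight M l k) := by
  induction k with
  | zero => exact Even.zero
  | succ k ih => exact ih.sub ⟨7 * (scaleLength M l k : ℤ), by ring⟩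

lemma reach_of_inTube {f' : ℕ → ℤ} {y : ℤ} {ℓ ℓ' : ℕ} (ha : a ≤ 1) (hℓ : ℓ ≤ ℓ')
    (haℓ : 25 * ℓ ≤ a * ℓ') (hf : IsPath p U f 0 (2 * ℓ')) (hg : IsPath p U g 0 (2 * ℓ'))
    (hf' : IsPath p U f' 0 ℓ') (hfT : InTube 0 y (2 * ℓ') (4 * ℓ) a f)
    (hgT : InTube 0 (y + 16 * ℓ) (2 * ℓ') (10 * ℓ) (-a) g)
    (hfT' : InTube 0 (y - 14 * ℓ) ℓ' (10 * ℓ) a f') :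
    Reach p U Set.univ ℓ (f ℓ) ℓ' (f' ℓ') := by
  refine reach_of_connector (hf.sub ℓ.zero_le (by omega)) (hg.sub ℓ.zero_le (by omega))
    (hf'.sub ℓ.zero_le le_rfl) hℓ (fun _ _ _ => trivial) (fun _ _ _ => trivial)
    (fun _ _ _ => trivial) ?_ ?_ fun n _ hn' => ?_
  · have hfs := (abs_le.1 (hfT ℓ ℓ.zero_le (by omega))).2
    have hgs := (abs_le.1 (hgT ℓ ℓ.zero_le (by omega))).1
    push_cast at hfs hgs
    have : (f ℓ : ℝ) ≤ g ℓ := by linarith [mul_le_of_le_one_left (Nat.cast_nonneg (α := ℝ) ℓ) ha]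
    exact_mod_cast this
  · have hge := (abs_le.1 (hgT ℓ' ℓ'.zero_le (by omega))).2
    have hfe := (abs_le.1 (hfT' ℓ' ℓ'.zero_le (by omega))).1
    push_cast at hge hfe
    have : (g ℓ' : ℝ) ≤ f' ℓ' := by linarith
    exact_mod_cast this
  · have hfn := (abs_le.1 (hfT n n.zero_le (by omega))).1
    have hfn' := (abs_le.1 (hfT' n n.zero_le (by omega))).2
    push_cast at hfn hfn'
    have : (f' n : ℝ) ≤ f n := by linarith [Nat.cast_nonneg (α := ℝ) ℓ]
    exact_mod_cast this

lemma iInter_chainLink_subset (hP : ScaleParams b M l) {c : ℕ → ℝ}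
    (hc : ∀ k, c k ∈ Set.Icc b 1) :
    ⋂ k, chainLink p M l c k ⊆ ⋃ y, {U | ∀ n, U ∈ pathEvent p 0 n fun h => h 0 = y} := by
  intro U hU
  rw [Set.mem_iInter] at hU
  choose f hf hfT hfT' using fun k => (hU k).1
  choose g hg hgT using fun k => (hU k).2
  have hlength (k : ℕ) : 2 * scaleFactor M k * scaleLength M l k = 2 * scaleLength M l (k + 1) := by
    rw [scaleLength, mul_assoc]
  simp only [hlength] at hf hfT
  simp only [zero_add, hP.scaleWidth_succ] at hg hgT
  have hle (k : ℕ) : scaleLength M l k ≤ scaleLength M l (k + 1) := hP.scaleLength_le_succ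
  have hchain (k : ℕ) :
      Reach p U Set.univ 0 (f 0 0) (scaleLength M l k) (f k (scaleLength M l k)) := by
    induction k with
    | zero =>
      exact (hf 0).reach (fun _ _ _ => Set.mem_univ _) le_rfl (Nat.zero_le _)
        (by have := hle 0; omega)
    | succ k ih =>
      have hnext := hfT' (k + 1)
      rw [hP.scaleWidth_succ] at hnext
      have hsteep : 25 * (scaleLength M l k : ℝ) ≤ c (k + 1) * scaleLength M l (k + 1) := by
        rw [scaleLength, Nat.cast_mul, ← mul_assoc]
        gcongr
        linarith [hP.le_slope_mul_scaleFactor (k := k) (hc (k + 1)).1]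
      exact ih.trans (reach_of_inTube (hc (k + 1)).2 (hle k) hsteep (hf k) (hg k)
        ((hf (k + 1)).sub le_rfl (by have := hle (k + 1); omega)) (hfT k) (hgT k) hnext)
  refine Set.mem_iUnion.2 ⟨f 0 0, fun n => ?_⟩
  obtain ⟨-, h, hh, -, h0, -⟩ := hchain n
  exact ⟨h, hh.sub le_rfl hP.lt_scaleLength.le, h0⟩

lemma law_chainLink_compl_le (hP : ScaleParams b M l) {c : ℕ → ℝ}
    (hgood : GoodScale p b M l (k + 1) (c (k + 1)))
    (hlane : law.real (lane p (startHeight M l k) (scaleLength M l k) (2 * scaleFactor M k)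
      (scaleWidth M l k) (c k) (c (k + 1)))ᶜ ≤ 4 * scaleFactor M k * scaleBound M k) :
    law.real (chainLink p M l c k)ᶜ ≤ (1 / 4) ^ k * (1 / 32) := by
  have heven : Even ((0 : ℤ) + (startHeight M l k + 16 * scaleLength M l k)) := by
    rw [zero_add]
    exact even_startHeight.add ⟨8 * (scaleLength M l k : ℤ), by ring⟩
  have htube := (law_tube_neg_compl_le (s := 0) heven _ _ _).trans
    (hgood.law_compl_le_scaleBound.trans hP.scaleBound_le)
  rw [pow_succ] at htube
  rw [chainLink, Set.compl_inter]
  have hpow : (0 : ℝ) < (1 / 4) ^ k := by positivity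
  linarith [hP.scaleFactor_mul_scaleBound_le (k := k), measureReal_union_le (μ := law)
    (lane p (startHeight M l k) (scaleLength M l k) (2 * scaleFactor M k) (scaleWidth M l k) (c k)
      (c (k + 1)))ᶜ (tube p 0 (startHeight M l k + 16 * scaleLength M l k)
        (2 * scaleLength M l (k + 1)) (scaleWidth M l (k + 1)) (-c (k + 1)))ᶜ]

lemma GoodScale.percolationProb_pos (hP : ScaleParams b M l) (h : GoodScale p b M l 0 a) :
    0 < percolationProb p := by
  obtain ⟨c, hc⟩ := h.exists_slopes hP
  have hsum : HasSum (fun k : ℕ => (1 / 4 : ℝ) ^ k * (1 / 32)) ((1 - 1 / 4)⁻¹ * (1 / 32)) :=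
    (hasSum_geometric_of_lt_one (by norm_num) (by norm_num)).mul_right _
  refine pos_iff_ne_zero.2 fun hzero => measure_iInter_ne_zero_of_hasSum_lt_one hsum
    (by norm_num) (fun k => law_chainLink_compl_le hP (hc (k + 1)).1 ((hc k).2 _ even_startHeight))
    (measure_mono_null
      (iInter_chainLink_subset hP fun k => ⟨(hc k).1.slope_le, (hc k).1.slope_le_one⟩)
      (measure_iUnion_null fun y => law_iInter_pathEvent_zero_eq_zero hzero y))

end Scales

lemma continuous_measureReal_tube_compl (s : ℕ) (y : ℤ) (L : ℕ) (w a : ℝ) :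
    Continuous fun q => law.real (tube q s y L w a)ᶜ := by
  simp only [probReal_compl_eq_one_sub (measurableSet_tube _ _ _ _ _ _)]
  refine continuous_const.sub (continuous_measureReal_pathEvent (a := y - ⌈w⌉ - L)
    (b := y + ⌈w⌉ + L) (dependsOn_inTube s y L w a) fun q U h hh htube n hn hn' => ?_)
  have hstart : |h s - y| ≤ ⌈w⌉ := by
    have hs := (htube s le_rfl (by omega)).trans (Int.le_ceil w)
    rw [sub_self, mul_zero, add_zero] at hs
    exact_mod_cast hs
  have hdist := abs_le.1 (hh.abs_sub_le le_rfl hn hn'.le)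
  rw [abs_le] at hstart
  exact ⟨by omega, by omega⟩

lemma exists_scaleParams {α b : ℝ} (hb : 0 < b) (hbα : b < α) :
    ∃ M : ℕ, b + 84 / M ≤ α ∧ ∀ l, M ≤ l → ScaleParams b M l := by
  obtain ⟨M, hM⟩ := exists_nat_gt (max 2 (max (62 / b) (84 / (α - b))))
  simp only [max_lt_iff] at hM
  obtain ⟨htwo, hslope, hgap⟩ := hM
  have hM0 : (0 : ℝ) < M := by linarith
  rw [div_lt_iff₀ hb] at hslope
  have hgap' : 84 / (M : ℝ) ≤ α - b := ((div_lt_comm₀ (sub_pos.2 hbα) hM0).1 hgap).le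
  exact ⟨M, by linarith, fun l hl => ⟨hb, by exact_mod_cast htwo.le, by linarith, hl⟩⟩

lemma exists_eventually_goodScale {b : ℝ} (hb : 0 < b) (hbp : (b : EReal) < edgeSpeed p) :
    ∃ (M l : ℕ) (a : ℝ), ScaleParams b M l ∧ ∀ᶠ q in 𝓝 p, GoodScale q b M l 0 a := by
  obtain ⟨α, hα⟩ : ∃ α : ℝ, edgeSpeed p = α :=
    ⟨_, (EReal.coe_toReal ((edgeSpeed_le_one p).trans_lt (EReal.coe_lt_top 1)).ne
      (bot_le.trans_lt hbp).ne').symm⟩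
  have hα1 : α ≤ 1 := by exact_mod_cast hα ▸ edgeSpeed_le_one p
  rw [hα, EReal.coe_lt_coe_iff] at hbp
  obtain ⟨M, hgap, hparams⟩ := exists_scaleParams hb hbp
  have hM : (0 : ℝ) < M := by
    exact_mod_cast zero_lt_two.trans_le (hparams M le_rfl).two_le
  have hκ : (0 : ℝ) < 1 / (256 * (M : ℝ) ^ 2) := by positivity
  obtain ⟨l, hl, hlt⟩ := exists_law_tube_compl_lt hα (abs_le.2 ⟨by linarith, hα1⟩)
    (show (0 : ℝ) < 20 / M by positivity) hκ M
  rw [div_mul_eq_mul_div] at hlt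
  have hcont := continuous_measureReal_tube_compl 0 0 (2 * l) (20 * l / M) α
  refine ⟨M, l, α, hparams l hl, (hcont.continuousAt.eventually_lt_const hlt).mono fun q hq => ?_⟩
  constructor
  · simpa only [scaleFactor, pow_zero, mul_one] using hgap
  · exact hα1
  · simpa only [scaleFactor, scaleLength, scaleWidth, scaleBound, pow_zero, mul_one] using hq.le

lemma eventually_le_edgeSpeed_and_percolationProb_pos {b : ℝ} (hb : 0 < b)
    (hbp : (b : EReal) < edgeSpeed p) :
    ∀ᶠ q in 𝓝 p, (b : EReal) ≤ edgeSpeed q ∧ 0 < percolationProb q := by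
  obtain ⟨M, l, a, hP, hgood⟩ := exists_eventually_goodScale hb hbp
  exact hgood.mono fun q hq => ⟨hq.le_edgeSpeed hP, hq.percolationProb_pos hP⟩

/-! ### The edge speed above the critical value -/

lemma criticalValue_le (hp : 0 < percolationProb p) (hp1 : p ≤ 1) : criticalValue ≤ p :=
  csInf_le ⟨0, fun _ hq => hq.1.1⟩ ⟨⟨(pos_of_percolationProb_pos hp).le, hp1⟩, hp⟩

lemma exists_lt_percolationProb_pos (hp : 0 < edgeSpeed p) : ∃ q < p, 0 < percolationProb q := by
  obtain ⟨b, hb, hbp⟩ := EReal.lt_iff_exists_real_btwn.1 hp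
  obtain ⟨q, ⟨-, hq⟩, hqp⟩ := (((eventually_le_edgeSpeed_and_percolationProb_pos
    (EReal.coe_pos.1 hb) hbp).filter_mono nhdsWithin_le_nhds).and
      (self_mem_nhdsWithin (s := Set.Iio p))).exists
  exact ⟨q, hqp, hq⟩

lemma exists_lt_one_percolationProb_pos : ∃ q < 1, 0 < percolationProb q :=
  exists_lt_percolationProb_pos (zero_lt_one.trans_le one_le_edgeSpeed_one)

lemma criticalValue_lt_one : criticalValue < 1 := by
  obtain ⟨q, hq1, hq⟩ := exists_lt_one_percolationProb_pos
  exact (criticalValue_le hq hq1.le).trans_lt hq1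

lemma edgeSpeed_nonneg_of_criticalValue_lt (hp : criticalValue < p) : 0 ≤ edgeSpeed p := by
  obtain ⟨r, hr1, hr⟩ := exists_lt_one_percolationProb_pos
  have hne : {q : ℝ | q ∈ Set.Icc (0 : ℝ) 1 ∧ 0 < percolationProb q}.Nonempty :=
    ⟨r, ⟨(pos_of_percolationProb_pos hr).le, hr1.le⟩, hr⟩
  obtain ⟨q, ⟨-, hq⟩, hqp⟩ := exists_lt_of_csInf_lt hne hp
  exact edgeSpeed_nonneg_of_percolationProb_pos (hq.trans_le (percolationProb_mono hqp.le))

lemma edgeSpeed_criticalValue : edgeSpeed criticalValue = 0 := by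
  refine le_antisymm (not_lt.1 fun hpos => ?_) (not_lt.1 fun hneg => ?_)
  · obtain ⟨q, hlt, hq⟩ := exists_lt_percolationProb_pos hpos
    exact hlt.not_ge (criticalValue_le hq (hlt.trans criticalValue_lt_one).le)
  · obtain ⟨q, hq, hlt⟩ := (((upperSemicontinuous_edgeSpeed criticalValue 0 hneg).filter_mono
      nhdsWithin_le_nhds).and (self_mem_nhdsWithin (s := Set.Ioi criticalValue))).exists
    exact hq.not_ge (edgeSpeed_nonneg_of_criticalValue_lt hlt)

lemma edgeSpeed_nonneg (hp : criticalValue ≤ p) : 0 ≤ edgeSpeed p :=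
  edgeSpeed_criticalValue.symm.le.trans (edgeSpeed_mono hp)

lemma continuousOn_edgeSpeed : ContinuousOn edgeSpeed (Set.Ici criticalValue) := by
  refine fun p _ => tendsto_order.2 ⟨fun c hc => ?_, fun c hc =>
    (upperSemicontinuous_edgeSpeed p c hc).filter_mono nhdsWithin_le_nhds⟩
  rcases lt_or_ge c 0 with hneg | hnonneg
  · filter_upwards [self_mem_nhdsWithin] with q hq
    exact hneg.trans_le (edgeSpeed_nonneg hq)
  · obtain ⟨b, hcb, hbp⟩ := EReal.lt_iff_exists_real_btwn.1 hc
    filter_upwards [nhdsWithin_le_nhds (eventually_le_edgeSpeed_and_percolationProb_pos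
      (EReal.coe_pos.1 (hnonneg.trans_lt hcb)) hbp)] with q hq
    exact hcb.trans_le hq.1

end OTSP

end

/-- The edge speed vanishes at the critical value; on `[p_c, 1]` it is finite and continuous. -/
theorem mainTheorem4 :
    OTSP.edgeSpeed OTSP.criticalValue = 0 ∧
      (∀ p ∈ Set.Icc OTSP.criticalValue 1,
        OTSP.edgeSpeed p ≠ ⊥ ∧ OTSP.edgeSpeed p ≠ ⊤) ∧
      ContinuousOn OTSP.edgeSpeed (Set.Icc OTSP.criticalValue 1) := by
  refine ⟨OTSP.edgeSpeed_criticalValue, fun p hp => ⟨?_, ?_⟩,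
    OTSP.continuousOn_edgeSpeed.mono Set.Icc_subset_Ici_self⟩
  · exact (EReal.bot_lt_zero.trans_le (OTSP.edgeSpeed_nonneg hp.1)).ne'
  · exact ((OTSP.edgeSpeed_le_one p).trans_lt (EReal.coe_lt_top 1)).ne
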